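/- Let $\varepsilon>0$ and let $\mathcal W=\mathcal W(\varepsilon)$ be the complex algebra generated by $a_+,a_-,b_+,b_-$ with $[a_-,a_+]=[b_-,b_+]=\varepsilon$ and all commutators of an $a_\pm$ with a $b_\pm$ equal to zero. Let $\dagger$ be the conjugate-linear antiautomorphism of $\mathcal W$ with $a_\pm^\dagger=a_\mp$, $b_\pm^\dagger=b_\mp$. The sums $S(s,t,u,v)$ of all distinct permutations of the word $a_-^s a_+^t b_-^u b_+^v$ form a basis of $\mathcal W$; the formal trace $\mathrm{tr}:\mathcal W\to\mathcal W$ is the linear map which sends $S(s,t,u,v)$ to the sum of the words obtained by deleting the last two letters from those of its words that end in $a_+a_-$, $a_-a_+$, $b_+b_-$ or $b_-b_+$ (the other words contribute $0$). Put $\Psi=\ker\mathrm{tr}$, $K_0=\tfrac12(a_+a_-+b_+b_-+\varepsilon)$, $J_-=a_-b_+$, $\mathrm{Ad}_T(w)=[T,w]$, and $\Psi_r=\{\xi\in\Psi : [K_0,\xi]=\varepsilon r\,\xi\}$ for $2r\in\mathbb Z$. For $R\ge0$ put $\hat R=(R^2+\tfrac14\varepsilon^2)^{1/2}$ and let $\rho:\mathcal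 W\to\Psi$ be the projection onto $\Psi$ with kernel $\{w(K_0-\hat R): w\in\mathcal W\}$. For $2n,n+r,n+m\in\mathbb Z$, $n\ge 0$, $|r|\le n$, $|m|\le n$ put $$P(n,r,m)=\varepsilon^{m-n}\Big(\frac{(n+m)!}{(2n)!\,(n-m)!}\Big)^{1/2}(\mathrm{Ad}_{J_-})^{n-m}\big(a_+^{n+r}b_-^{n-r}\big).$$ Let $\mathcal H$ be the Fock space with orthonormal basis $|k,j\rangle$ ($2k,\,k+j\in\mathbb Z$, $k\ge0$, $|j|\le k$), on whose finite linear combinations $\mathcal W$ acts by $$a_+|k,j\rangle=\varepsilon^{1/2}(k+j+1)^{1/2}|k+\tfrac12,j+\tfrac12\rangle,\qquad b_+|k,j\rangle=\varepsilon^{1/2}(k-j+1)^{1/2}|k+\tfrac12,j-\tfrac12\rangle,$$ $$a_-|k,j\rangle=\varepsilon^{1/2}(k+j)^{1/2}|k-\tfrac12,j-\tfrac12\rangle,\qquad b_-|k,j\rangle=\varepsilon^{1/2}(k-j)^{1/2}|k-\tfrac12,j+\tfrac12\rangle.$$ **Lemma.** Let $2k\in\mathbb Z$, $k\ge0$, $2r\in\mathbb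 Z$ with $2k+2r+1\ge0$, and suppose $\hat R=\varepsilon(k+\tfrac12)$. Let $$\varphi^r_k:\Psi_r\to M_{(2k+2r+1)\times(2k+1)}(\mathbb C),\qquad (\varphi^r_k(\xi))_{\mu\nu}=\langle k+r,\mu-k-r-1|\,\xi\,|k,\nu-k-1\rangle,$$ for $1\le\mu\le 2k+2r+1$, $1\le\nu\le 2k+1$ (if $2k+2r+1=0$ the matrices are empty). Then: 1. for all $\xi\in\Psi_r$ and $f\in\Psi_0$: $\rho(\xi f)\in\Psi_r$ and $\varphi^r_k(\rho(\xi f))=\varphi^r_k(\xi)\,\varphi^0_k(f)$; 2. for all $\xi,\zeta\in\Psi_r$: $\rho(\xi^\dagger\zeta)\in\Psi_0$ and $(\varphi^r_k(\xi))^\dagger\varphi^r_k(\zeta)=\varphi^0_k(\rho(\xi^\dagger\zeta))$, where $\dagger$ on matrices is the conjugate transpose; 3. for all $n,m$ such that $P(n,r,m)$ is defined and $n\ge 2k+r+1$: $P(n,r,m)\in\Psi_r$ and $\varphi^r_k(P(n,r,m))=0$. -/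

import Mathlib

namespace NCSphere

/-- The four generators `a₊, a₋, b₊, b₋`. -/
inductive Gen
  | aP | aM | bP | bM
  deriving DecidableEq

instance : Fintype Gen := ⟨{.aP, .aM, .bP, .bM}, by intro g; cases g <;> decide⟩

theorem Gen.sum_eq {A : Type*} [AddCommMonoid A] (F : Gen → A) :
    ∑ g, F g = F .aP + (F .aM + (F .bP + F .bM)) := by
  change ∑ g ∈ ({.aP, .aM, .bP, .bM} : Finset Gen), F g = _
  rw [Finset.sum_insert (by decide), Finset.sum_insert (by decide),
    Finset.sum_insert (by decide), Finset.sum_singleton]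

/-- The exchange `a₊ ↔ a₋`, `b₊ ↔ b₋`. -/
def Gen.conj : Gen → Gen
  | .aP => .aM
  | .aM => .aP
  | .bP => .bM
  | .bM => .bP

/-- The commutators of the generators: `[a₋, a₊] = ε`, `[b₋, b₊] = ε`, antisymmetric,
and every other commutator (in particular of an `a` with a `b`) is zero. -/
def Gen.comm (ε : ℝ) : Gen → Gen → ℂ
  | .aM, .aP => ε
  | .aP, .aM => -ε
  | .bM, .bP => ε
  | .bP, .bM => -ε
  | _, _ => 0

/-- The defining relations `g h = h g + [g, h]`. -/
inductive Rel (ε : ℝ) : FreeAlgebra ℂ Gen → FreeAlgebra ℂ Gen → Prop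
  | comm (g h : Gen) : Rel ε (FreeAlgebra.ι ℂ g * FreeAlgebra.ι ℂ h)
      (FreeAlgebra.ι ℂ h * FreeAlgebra.ι ℂ g + algebraMap ℂ _ (Gen.comm ε g h))

/-- The product `𝒲(ε)` of two Heisenberg-Weil algebras: the free complex algebra on
`a₊, a₋, b₊, b₋` modulo the commutation relations. -/
def W (ε : ℝ) : Type := RingQuot (Rel ε)

instance (ε : ℝ) : Ring (W ε) := inferInstanceAs (Ring (RingQuot (Rel ε)))
instance (ε : ℝ) : Algebra ℂ (W ε) := inferInstanceAs (Algebra ℂ (RingQuot (Rel ε)))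

/-- A generator as an element of `𝒲(ε)`. -/
noncomputable def gen (ε : ℝ) (g : Gen) : W ε :=
  RingQuot.mkAlgHom ℂ (Rel ε) (FreeAlgebra.ι ℂ g)

theorem gen_mul_gen (ε : ℝ) (g h : Gen) :
    gen ε g * gen ε h = gen ε h * gen ε g + algebraMap ℂ (W ε) (Gen.comm ε g h) := by
  have := RingQuot.mkAlgHom_rel ℂ (Rel.comm (ε := ε) g h)
  simp only [map_mul, map_add, AlgHom.commutes] at this
  exact this

/-- The universal property of `𝒲(ε)`. -/
noncomputable def W.lift (ε : ℝ) {A : Type*} [Ring A] [Algebra ℂ A] (f : Gen → A)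
    (hf : ∀ g h, f g * f h = f h * f g + algebraMap ℂ A (Gen.comm ε g h)) : W ε →ₐ[ℂ] A :=
  RingQuot.liftAlgHom ℂ ⟨FreeAlgebra.lift ℂ f, by
    rintro _ _ ⟨g, h⟩
    simpa using hf g h⟩

@[simp] theorem W.lift_gen (ε : ℝ) {A : Type*} [Ring A] [Algebra ℂ A] (f : Gen → A)
    (hf : ∀ g h, f g * f h = f h * f g + algebraMap ℂ A (Gen.comm ε g h)) (g : Gen) :
    W.lift ε f hf (gen ε g) = f g := by
  have := RingQuot.liftAlgHom_mkAlgHom_apply (S := ℂ) (FreeAlgebra.lift ℂ f)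
    (s := Rel ε) (by rintro _ _ ⟨g, h⟩; simpa using hf g h) (FreeAlgebra.ι ℂ g)
  rw [FreeAlgebra.lift_ι_apply] at this
  exact this

theorem W.hom_ext {ε : ℝ} {A : Type*} [Ring A] [Algebra ℂ A] {f g : W ε →ₐ[ℂ] A}
    (h : ∀ x, f (gen ε x) = g (gen ε x)) : f = g := by
  apply RingQuot.ringQuot_ext'
  apply FreeAlgebra.hom_ext
  funext x
  exact h x

/-- The opposite ring of `𝒲(ε)`, with complex scalars acting through their conjugates. -/
def ConjOp (ε : ℝ) : Type := (W ε)ᵐᵒᵖ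

noncomputable instance (ε : ℝ) : Ring (ConjOp ε) := inferInstanceAs (Ring (W ε)ᵐᵒᵖ)

noncomputable instance (ε : ℝ) : Algebra ℂ (ConjOp ε) :=
  RingHom.toAlgebra' ((algebraMap ℂ (W ε)ᵐᵒᵖ).comp (starRingEnd ℂ))
    (fun c x => Algebra.commutes (A := (W ε)ᵐᵒᵖ) (starRingEnd ℂ c) x)

theorem Gen.conj_comm (ε : ℝ) (g h : Gen) :
    Gen.comm ε h.conj g.conj = starRingEnd ℂ (Gen.comm ε g h) := by
  cases g <;> cases h <;> simp [Gen.comm, Gen.conj]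

/-- The conjugation as a homomorphism into the conjugate opposite algebra. -/
noncomputable def daggerHom (ε : ℝ) : W ε →ₐ[ℂ] ConjOp ε :=
  W.lift ε (fun g => (MulOpposite.op (gen ε g.conj) : (W ε)ᵐᵒᵖ)) (by
    intro g h
    have := congrArg MulOpposite.op (gen_mul_gen ε h.conj g.conj)
    rw [Gen.conj_comm] at this
    exact this)

/-- The conjugation `w ↦ w†` of `𝒲(ε)`: the conjugate-linear antiautomorphism exchanging
`a₊ ↔ a₋` and `b₊ ↔ b₋`. -/
noncomputable def dagger (ε : ℝ) (w : W ε) : W ε :=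
  MulOpposite.unop (daggerHom ε w : (W ε)ᵐᵒᵖ)

theorem dagger_gen (ε : ℝ) (g : Gen) : dagger ε (gen ε g) = gen ε g.conj := by
  exact congrArg (fun x : (W ε)ᵐᵒᵖ => MulOpposite.unop x)
    (W.lift_gen ε (A := ConjOp ε) _ _ g)

theorem dagger_mul (ε : ℝ) (v w : W ε) : dagger ε (v * w) = dagger ε w * dagger ε v := by
  simp only [dagger, map_mul]
  rfl

theorem dagger_add (ε : ℝ) (v w : W ε) : dagger ε (v + w) = dagger ε v + dagger ε w := by
  simp only [dagger, map_add]
  rfl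

theorem dagger_algebraMap (ε : ℝ) (c : ℂ) :
    dagger ε (algebraMap ℂ (W ε) c) = algebraMap ℂ (W ε) (starRingEnd ℂ c) := by
  simp only [dagger, AlgHom.commutes]
  rfl

/-! ### Words and totally symmetric polynomials -/

/-- The product in `𝒲(ε)` of the letters of a word. -/
noncomputable def word (ε : ℝ) (l : List Gen) : W ε := (l.map (gen ε)).prod

/-- The distinct words that are arrangements of a given multiset of letters. -/
def arrangements (M : Multiset Gen) : Finset (List Gen) := M.lists.toFinset

theorem mem_arrangements {M : Multiset Gen} {l : List Gen} :
    l ∈ arrangements M ↔ M = (l : Multiset Gen) := by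
  simp [arrangements]

/-- The totally symmetric polynomial `S(s,t,u,v)`, where `M` is the multiset with `s` letters `a₋`,
`t` letters `a₊`, `u` letters `b₋` and `v` letters `b₊`: the sum of all distinct permutations of
`a₋ˢ a₊ᵗ b₋ᵘ b₊ᵛ`, each with coefficient one. -/
noncomputable def symPoly (ε : ℝ) (M : Multiset Gen) : W ε := ∑ l ∈ arrangements M, word ε l

theorem sum_arrangements {A : Type*} [AddCommMonoid A] {M : Multiset Gen} (hM : M ≠ 0)
    (F : List Gen → A) :
    ∑ l ∈ arrangements M, F l =
      ∑ g ∈ M.toFinset, ∑ l ∈ arrangements (M.erase g), F (g :: l) := by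
  rw [Finset.sum_sigma']
  symm
  refine Finset.sum_bij' (fun p _ => p.1 :: p.2)
    (fun l _ => ⟨l.headD .aP, l.tail⟩) ?_ ?_ ?_ ?_ ?_
  · rintro ⟨g, l⟩ h
    simp only [Finset.mem_sigma, Multiset.mem_toFinset, mem_arrangements] at h ⊢
    rw [← Multiset.cons_coe, ← h.2, Multiset.cons_erase h.1]
  · intro l h
    rw [mem_arrangements] at h
    subst h
    cases l with
    | nil => simp at hM
    | cons g l => simp [mem_arrangements]
  · rintro ⟨g, l⟩ h
    simp
  · intro l h
    rw [mem_arrangements] at h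
    subst h
    cases l with
    | nil => simp at hM
    | cons g l => simp
  · rintro ⟨g, l⟩ h
    rfl

theorem sum_arrangements_reverse {A : Type*} [AddCommMonoid A] (M : Multiset Gen)
    (F : List Gen → A) :
    ∑ l ∈ arrangements M, F l.reverse = ∑ l ∈ arrangements M, F l := by
  refine Finset.sum_bij' (fun l _ => l.reverse) (fun l _ => l.reverse) ?_ ?_ ?_ ?_ ?_ <;>
    intro l h <;> simp_all [mem_arrangements]

theorem arrangements_zero : arrangements 0 = {[]} := by
  ext l
  rw [mem_arrangements, eq_comm]
  simp

/-- The number of arrangements, as a complex number. -/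
noncomputable def cnt (M : Multiset Gen) : ℂ := ((arrangements M).card : ℂ)

theorem cnt_ne_zero (M : Multiset Gen) : cnt M ≠ 0 := by
  simp only [cnt, ne_eq, Nat.cast_eq_zero, Finset.card_eq_zero]
  rw [← ne_eq, ← Finset.nonempty_iff_ne_empty]
  exact ⟨M.toList, by simp [mem_arrangements]⟩

theorem cnt_eq_sum {M : Multiset Gen} (hM : M ≠ 0) :
    cnt M = ∑ g ∈ M.toFinset, cnt (M.erase g) := by
  have := sum_arrangements hM (fun _ => (1 : ℂ))
  simpa [cnt] using this

theorem sum_count (M : Multiset Gen) (F : Gen → ℂ) :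
    ∑ g ∈ M.toFinset, (M.count g : ℂ) * F g = ∑ g, (M.count g : ℂ) * F g := by
  apply Finset.sum_subset (Finset.subset_univ _)
  intro g _ hg
  simp [Multiset.count_eq_zero.2 (by simpa using hg)]

theorem cnt_mul (M : Multiset Gen) :
    cnt M * ∏ g, ((M.count g).factorial : ℂ) = ((M.card).factorial : ℂ) := by
  induction hN : M.card generalizing M with
  | zero =>
    rw [Multiset.card_eq_zero] at hN
    subst hN
    simp [cnt, arrangements_zero]
  | succ N ih =>
    have hM : M ≠ 0 := by rintro rfl; simp at hN
    rw [cnt_eq_sum hM, Finset.sum_mul]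
    have key : ∀ g ∈ M.toFinset, cnt (M.erase g) * ∏ h, ((M.count h).factorial : ℂ) =
        (M.count g : ℂ) * (N.factorial : ℂ) := by
      intro g hg
      rw [Multiset.mem_toFinset] at hg
      rw [← ih (M.erase g) (by rw [Multiset.card_erase_of_mem hg, hN]; rfl)]
      have hp := Multiset.count_pos.2 hg
      have : ∀ h ∈ Finset.univ.erase g, ((M.count h).factorial : ℂ) =
          (((M.erase g).count h).factorial : ℂ) := by
        intro h hh
        rw [Multiset.count_erase_of_ne (Finset.ne_of_mem_erase hh)]
      rw [← Finset.mul_prod_erase Finset.univ _ (Finset.mem_univ g),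
        ← Finset.mul_prod_erase Finset.univ (fun h => (((M.erase g).count h).factorial : ℂ))
          (Finset.mem_univ g), Finset.prod_congr rfl this, Multiset.count_erase_self]
      obtain ⟨c, hc⟩ := Nat.exists_eq_succ_of_ne_zero hp.ne'
      rw [hc]
      simp only [Nat.succ_eq_add_one, Nat.factorial_succ, Nat.add_sub_cancel]
      push_cast
      ring
    rw [Finset.sum_congr rfl key, ← Finset.sum_mul, Nat.factorial_succ, ← hN,
      ← Multiset.toFinset_sum_count_eq]
    push_cast
    rfl

theorem cnt_erase {M : Multiset Gen} {g : Gen} (hg : g ∈ M) :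
    (M.card : ℂ) * cnt (M.erase g) = (M.count g : ℂ) * cnt M := by
  have h1 := cnt_mul M
  have h2 := cnt_mul (M.erase g)
  have hp := Multiset.count_pos.2 hg
  have : ∀ h ∈ Finset.univ.erase g, ((M.count h).factorial : ℂ) =
      (((M.erase g).count h).factorial : ℂ) := by
    intro h hh
    rw [Multiset.count_erase_of_ne (Finset.ne_of_mem_erase hh)]
  rw [← Finset.mul_prod_erase Finset.univ _ (Finset.mem_univ g),
    Finset.prod_congr rfl this] at h1
  rw [← Finset.mul_prod_erase Finset.univ _ (Finset.mem_univ g), Multiset.count_erase_self,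
    Multiset.card_erase_of_mem hg] at h2
  obtain ⟨c, hc⟩ := Nat.exists_eq_succ_of_ne_zero hp.ne'
  obtain ⟨N, hN⟩ := Nat.exists_eq_succ_of_ne_zero (Multiset.card_pos_iff_exists_mem.2 ⟨g, hg⟩).ne'
  rw [hc, hN, Nat.succ_eq_add_one, Nat.succ_eq_add_one, Nat.factorial_succ, Nat.factorial_succ]
    at h1
  rw [hc, hN, Nat.succ_eq_add_one, Nat.succ_eq_add_one, Nat.add_sub_cancel, Nat.pred_succ] at h2
  rw [hc, hN]
  have hP : (c.factorial : ℂ) * ∏ h ∈ Finset.univ.erase g,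
      (((M.erase g).count h).factorial : ℂ) ≠ 0 := by
    apply mul_ne_zero
    · exact_mod_cast c.factorial_ne_zero
    · rw [Finset.prod_ne_zero_iff]
      intro h _
      exact_mod_cast Nat.factorial_ne_zero _
  apply mul_right_cancel₀ hP
  push_cast at h1 h2 ⊢
  linear_combination ((N : ℂ) + 1) * h2 - h1

/-! ### The totally symmetric polynomials form a basis -/

/-- Weyl symbols: the commutative polynomials in the four letters, with the monomials (multisets
of letters) as basis. -/
abbrev Symb : Type := Multiset Gen →₀ ℂ

/-- A monomial. -/
noncomputable abbrev mon (M : Multiset Gen) : Symb := Finsupp.single M 1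

/-- Multiplication by a letter. -/
noncomputable def up (g : Gen) : Symb →ₗ[ℂ] Symb :=
  Finsupp.linearCombination ℂ (fun M => mon (g ::ₘ M))

/-- Differentiation in a letter. -/
noncomputable def down (g : Gen) : Symb →ₗ[ℂ] Symb :=
  Finsupp.linearCombination ℂ (fun M => (M.count g : ℂ) • mon (M.erase g))

@[simp] theorem up_mon (g : Gen) (M : Multiset Gen) : up g (mon M) = mon (g ::ₘ M) := by
  simp [up]

@[simp] theorem down_mon (g : Gen) (M : Multiset Gen) :
    down g (mon M) = (M.count g : ℂ) • mon (M.erase g) := by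
  simp [down]

theorem sym_ext {A : Type*} [AddCommMonoid A] [Module ℂ A] {f g : Symb →ₗ[ℂ] A}
    (h : ∀ M, f (mon M) = g (mon M)) : f = g :=
  Finsupp.lhom_ext' fun M => LinearMap.ext_ring (h M)

theorem up_up (g h : Gen) (v : Symb) : up g (up h v) = up h (up g v) := by
  have : up g ∘ₗ up h = up h ∘ₗ up g := sym_ext fun M => by
    simp [Multiset.cons_swap]
  exact LinearMap.congr_fun this v

theorem down_down (g h : Gen) (v : Symb) : down g (down h v) = down h (down g v) := by
  have : down g ∘ₗ down h = down h ∘ₗ down g := sym_ext fun M => by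
    by_cases e : g = h
    · rw [e]
    · simp only [LinearMap.comp_apply, down_mon, map_smul, Multiset.erase_comm M g h,
        Multiset.count_erase_of_ne e, Multiset.count_erase_of_ne (Ne.symm e), smul_smul]
      rw [mul_comm]
  exact LinearMap.congr_fun this v

theorem down_up (g h : Gen) (v : Symb) :
    down g (up h v) = up h (down g v) + (if g = h then v else 0) := by
  have : down g ∘ₗ up h = up h ∘ₗ down g + (if g = h then LinearMap.id else 0) :=
    sym_ext fun M => by
      by_cases e : g = h
      · subst e
        simp only [LinearMap.comp_apply, up_mon, down_mon, Multiset.count_cons_self,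
          Multiset.erase_cons_head, map_smul, LinearMap.add_apply, if_true, LinearMap.id_apply]
        by_cases hg : g ∈ M
        · rw [Multiset.cons_erase hg]
          push_cast
          rw [add_smul, one_smul]
        · simp [Multiset.count_eq_zero.2 hg]
      · simp only [LinearMap.comp_apply, up_mon, down_mon, Multiset.count_cons_of_ne e, map_smul,
          if_neg e, add_zero]
        rw [Multiset.erase_cons_tail _ (Ne.symm e)]
  have := LinearMap.congr_fun this v
  simp only [LinearMap.comp_apply, LinearMap.add_apply] at this
  rw [this]
  split_ifs <;> simp

/-- Left multiplication by a letter, on Weyl symbols. -/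
noncomputable def leftOp (ε : ℝ) (g : Gen) : Module.End ℂ Symb :=
  up g + (Gen.comm ε g g.conj / 2) • down g.conj

theorem leftOp_comm (ε : ℝ) (g h : Gen) :
    leftOp ε g * leftOp ε h =
      leftOp ε h * leftOp ε g + algebraMap ℂ (Module.End ℂ Symb) (Gen.comm ε g h) := by
  apply LinearMap.ext
  intro v
  have e : ∀ x y : Gen, leftOp ε x (leftOp ε y v) = up x (up y v) +
      (Gen.comm ε y y.conj / 2) • up x (down y.conj v) +
      (Gen.comm ε x x.conj / 2) • up y (down x.conj v) +
      (if x.conj = y then (Gen.comm ε x x.conj / 2) • v else 0) +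
      (Gen.comm ε x x.conj / 2 * (Gen.comm ε y y.conj / 2)) • down x.conj (down y.conj v) := by
    intro x y
    simp only [leftOp, LinearMap.add_apply, LinearMap.smul_apply, map_add, map_smul, down_up,
      smul_add, smul_smul]
    split_ifs <;> module
  simp only [Module.End.mul_apply, LinearMap.add_apply, Module.algebraMap_end_apply, e,
    up_up h g, down_down h.conj g.conj]
  have : (if g.conj = h then (Gen.comm ε g g.conj / 2) • v else 0) =
      (if h.conj = g then (Gen.comm ε h h.conj / 2) • v else 0) + Gen.comm ε g h • v := by
    cases g <;> cases h <;>
      simp only [Gen.conj, Gen.comm, reduceCtorEq, if_true, if_false] <;> module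
  rw [this]
  module

/-- The action of `𝒲(ε)` on Weyl symbols. -/
noncomputable def symAction (ε : ℝ) : W ε →ₐ[ℂ] Module.End ℂ Symb :=
  W.lift ε (leftOp ε) (leftOp_comm ε)

theorem word_cons (ε : ℝ) (g : Gen) (l : List Gen) :
    word ε (g :: l) = gen ε g * word ε l := by
  simp [word]

theorem word_append (ε : ℝ) (l l' : List Gen) :
    word ε (l ++ l') = word ε l * word ε l' := by
  simp [word]

theorem symPoly_zero (ε : ℝ) : symPoly ε 0 = 1 := by
  simp [symPoly, arrangements_zero, word]

theorem symPoly_rec (ε : ℝ) {M : Multiset Gen} (hM : M ≠ 0) :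
    symPoly ε M = ∑ g ∈ M.toFinset, gen ε g * symPoly ε (M.erase g) := by
  simp only [symPoly, sum_arrangements hM, word_cons, Finset.mul_sum]

theorem symAction_symPoly (ε : ℝ) (M : Multiset Gen) :
    symAction ε (symPoly ε M) (mon 0) = cnt M • mon M := by
  induction hN : M.card generalizing M with
  | zero =>
    rw [Multiset.card_eq_zero] at hN
    subst hN
    simp [symPoly_zero, cnt, arrangements_zero]
  | succ N ih =>
    have hM : M ≠ 0 := by rintro rfl; simp at hN
    have hN0 : ((M.card : ℕ) : ℂ) ≠ 0 := by rw [hN]; exact_mod_cast N.succ_ne_zero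
    have key : ∀ g ∈ M.toFinset, symAction ε (gen ε g * symPoly ε (M.erase g)) (mon 0) =
        cnt (M.erase g) • mon M + (M.count g : ℂ) • ((cnt M / M.card) •
          (Gen.comm ε g g.conj / 2) • ((M.count g.conj : ℂ) • mon ((M.erase g).erase g.conj))) := by
      intro g hg
      rw [Multiset.mem_toFinset] at hg
      have hne : g.conj ≠ g := by cases g <;> simp [Gen.conj]
      rw [map_mul, Module.End.mul_apply, ih _ (by rw [Multiset.card_erase_of_mem hg, hN]; rfl),
        symAction, W.lift_gen]
      simp only [leftOp, LinearMap.add_apply, LinearMap.smul_apply, map_smul, up_mon, down_mon,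
        Multiset.cons_erase hg, Multiset.count_erase_of_ne hne, smul_add, smul_smul]
      congr 2
      have := cnt_erase hg
      field_simp
      linear_combination (Gen.comm ε g g.conj * (M.count g.conj : ℂ)) * this
    rw [symPoly_rec ε hM, map_sum, LinearMap.sum_apply, Finset.sum_congr rfl key,
      Finset.sum_add_distrib, ← Finset.sum_smul, ← cnt_eq_sum hM, add_eq_left]
    rw [Finset.sum_subset (Finset.subset_univ _) (fun g _ hg => by
      rw [Multiset.count_eq_zero.2 (by simpa using hg), Nat.cast_zero, zero_smul])]
    simp only [Gen.sum_eq, Gen.conj, Gen.comm, Multiset.erase_comm M .aM .aP,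
      Multiset.erase_comm M .bM .bP]
    module

/-- The map sending a Weyl symbol to the symmetric polynomial that it represents. -/
noncomputable def quant (ε : ℝ) : Symb →ₗ[ℂ] W ε :=
  Finsupp.linearCombination ℂ (fun M => (cnt M)⁻¹ • symPoly ε M)

theorem quant_mon (ε : ℝ) (M : Multiset Gen) : quant ε (mon M) = (cnt M)⁻¹ • symPoly ε M := by
  simp [quant]

theorem symAction_quant (ε : ℝ) (v : Symb) : symAction ε (quant ε v) (mon 0) = v := by
  have : (LinearMap.applyₗ (mon 0)) ∘ₗ (symAction ε).toLinearMap ∘ₗ quant ε = LinearMap.id :=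
    sym_ext fun M => by
      simp [quant_mon, symAction_symPoly, -Finsupp.smul_single, smul_smul, cnt_ne_zero]
  exact LinearMap.congr_fun this v

theorem quant_injective (ε : ℝ) : Function.Injective (quant ε) :=
  Function.LeftInverse.injective (g := fun w => symAction ε w (mon 0)) (symAction_quant ε)

/-- The span of the words with fewer than `N` letters. -/
noncomputable def wordsLT (ε : ℝ) (N : ℕ) : Submodule ℂ (W ε) :=
  Submodule.span ℂ {w | ∃ l : List Gen, l.length < N ∧ w = word ε l}

theorem word_mem (ε : ℝ) {N : ℕ} {l : List Gen} (h : l.length < N) : word ε l ∈ wordsLT ε N :=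
  Submodule.subset_span ⟨l, h, rfl⟩

theorem wordsLT_mono (ε : ℝ) {N N' : ℕ} (h : N ≤ N') : wordsLT ε N ≤ wordsLT ε N' :=
  Submodule.span_mono fun _ ⟨l, hl, e⟩ => ⟨l, hl.trans_le h, e⟩

theorem gen_mul_mem (ε : ℝ) {N : ℕ} (g : Gen) {w : W ε} (h : w ∈ wordsLT ε N) :
    gen ε g * w ∈ wordsLT ε (N + 1) := by
  induction h using Submodule.span_induction with
  | mem x hx =>
    obtain ⟨l, hl, rfl⟩ := hx
    rw [← word_cons]
    exact word_mem ε (by simpa using hl)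
  | zero => simp
  | add x y _ _ hx hy => rw [mul_add]; exact add_mem hx hy
  | smul c x _ hx => rw [mul_smul_comm]; exact Submodule.smul_mem _ _ hx

theorem mul_word_mem (ε : ℝ) {N : ℕ} (l' : List Gen) {w : W ε} (h : w ∈ wordsLT ε N) :
    w * word ε l' ∈ wordsLT ε (N + l'.length) := by
  induction h using Submodule.span_induction with
  | mem x hx =>
    obtain ⟨l, hl, rfl⟩ := hx
    rw [← word_append]
    exact word_mem ε (by simpa using hl)
  | zero => simp
  | add x y _ _ hx hy => rw [add_mul]; exact add_mem hx hy
  | smul c x _ hx => rw [smul_mul_assoc]; exact Submodule.smul_mem _ _ hx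

theorem word_sub_mem (ε : ℝ) {l l' : List Gen} (h : l.Perm l') :
    word ε l - word ε l' ∈ wordsLT ε l.length := by
  induction h with
  | nil => simp
  | cons g _ ih =>
    rw [word_cons, word_cons, ← mul_sub]
    exact gen_mul_mem ε g ih
  | swap g h l =>
    simp only [word_cons, ← mul_assoc]
    rw [← sub_mul, gen_mul_gen ε h g, add_sub_cancel_left, ← Algebra.smul_def]
    exact Submodule.smul_mem _ _ (word_mem ε (by simp))
  | trans h₁ h₂ ih₁ ih₂ =>
    rw [← sub_add_sub_cancel]
    rw [← h₁.length_eq] at ih₂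
    exact add_mem ih₁ ih₂

theorem quant_sub_word_mem (ε : ℝ) (l : List Gen) :
    quant ε (mon (l : Multiset Gen)) - word ε l ∈ wordsLT ε l.length := by
  have : quant ε (mon (l : Multiset Gen)) - word ε l =
      (cnt (l : Multiset Gen))⁻¹ • ∑ l' ∈ arrangements l, (word ε l' - word ε l) := by
    rw [Finset.sum_sub_distrib, Finset.sum_const, quant_mon, smul_sub, symPoly,
      ← Nat.cast_smul_eq_nsmul ℂ, smul_smul]
    change _ = _ - ((cnt _)⁻¹ * cnt _) • _
    rw [inv_mul_cancel₀ (cnt_ne_zero _), one_smul]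
  rw [this]
  refine Submodule.smul_mem _ _ (Submodule.sum_mem _ fun l' hl' => ?_)
  rw [mem_arrangements, Multiset.coe_eq_coe] at hl'
  rw [hl'.length_eq]
  exact word_sub_mem ε hl'.symm

/-- The symbols of degree less than `N`. -/
noncomputable def symLT (N : ℕ) : Submodule ℂ Symb :=
  Finsupp.supported ℂ ℂ {M : Multiset Gen | M.card < N}

theorem mon_mem {N : ℕ} {M : Multiset Gen} (h : M.card < N) : mon M ∈ symLT N :=
  Finsupp.single_mem_supported ℂ _ h

theorem symLT_mono {N N' : ℕ} (h : N ≤ N') : symLT N ≤ symLT N' :=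
  Finsupp.supported_mono fun _ hM => lt_of_lt_of_le hM h

theorem symLT_le {A : Submodule ℂ Symb} {N : ℕ} (h : ∀ M : Multiset Gen, M.card < N → mon M ∈ A) :
    symLT N ≤ A := by
  rw [symLT, Finsupp.supported_eq_span_single, Submodule.span_le]
  rintro _ ⟨M, hM, rfl⟩
  exact h M hM

theorem map_quant (ε : ℝ) (N : ℕ) : (symLT N).map (quant ε) = wordsLT ε N := by
  induction N with
  | zero =>
    apply le_antisymm
    · rw [Submodule.map_le_iff_le_comap]
      exact symLT_le fun M hM => absurd hM (Nat.not_lt_zero _)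
    · rw [wordsLT, Submodule.span_le]
      rintro _ ⟨l, hl, rfl⟩
      exact absurd hl (Nat.not_lt_zero _)
  | succ N ih =>
    apply le_antisymm
    · rw [Submodule.map_le_iff_le_comap]
      refine symLT_le fun M hM => ?_
      induction M using Quotient.inductionOn with
      | h l =>
        have h1 := wordsLT_mono ε (Nat.le_of_lt hM) (quant_sub_word_mem ε l)
        have h2 : word ε l ∈ wordsLT ε (N + 1) := word_mem ε hM
        have h3 := add_mem h1 h2
        rw [sub_add_cancel] at h3
        exact h3
    · rw [wordsLT, Submodule.span_le]
      rintro _ ⟨l, hl, rfl⟩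
      have h1 := wordsLT_mono ε (Nat.le_of_lt_succ hl) (quant_sub_word_mem ε l)
      rw [← ih] at h1
      have h2 := Submodule.map_mono (f := quant ε) (symLT_mono N.le_succ) h1
      have h3 : quant ε (mon (l : Multiset Gen)) ∈ (symLT (N + 1)).map (quant ε) :=
        ⟨_, mon_mem (by simpa using hl), rfl⟩
      have h4 := sub_mem h3 h2
      rw [sub_sub_cancel] at h4
      exact h4

theorem mul_mem_wordsLT (ε : ℝ) {N N' : ℕ} {v w : W ε} (hv : v ∈ wordsLT ε N)
    (hw : w ∈ wordsLT ε N') : v * w ∈ wordsLT ε (N + N') := by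
  induction hw using Submodule.span_induction with
  | mem x hx =>
    obtain ⟨l, hl, rfl⟩ := hx
    exact wordsLT_mono ε (by omega) (mul_word_mem ε l hv)
  | zero => simp
  | add x y _ _ hx hy => rw [mul_add]; exact add_mem hx hy
  | smul c x _ hx => rw [mul_smul_comm]; exact Submodule.smul_mem _ _ hx

theorem exists_mem_wordsLT (ε : ℝ) (w : W ε) : ∃ N, w ∈ wordsLT ε N := by
  obtain ⟨x, rfl⟩ := RingQuot.mkAlgHom_surjective ℂ (Rel ε) w
  induction x using FreeAlgebra.induction with
  | grade0 c =>
    refine ⟨1, ?_⟩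
    rw [AlgHom.commutes, Algebra.algebraMap_eq_smul_one]
    exact Submodule.smul_mem _ _ (word_mem ε (l := []) (by simp))
  | grade1 g =>
    refine ⟨2, ?_⟩
    have := word_mem ε (l := [g]) (N := 2) (by simp)
    rwa [word, List.map_singleton, List.prod_singleton] at this
  | mul x y hx hy =>
    obtain ⟨N, hN⟩ := hx
    obtain ⟨N', hN'⟩ := hy
    exact ⟨N + N', by rw [map_mul]; exact mul_mem_wordsLT ε hN hN'⟩
  | add x y hx hy =>
    obtain ⟨N, hN⟩ := hx
    obtain ⟨N', hN'⟩ := hy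
    refine ⟨max N N', ?_⟩
    rw [map_add]
    exact add_mem (wordsLT_mono ε (le_max_left _ _) hN) (wordsLT_mono ε (le_max_right _ _) hN')

theorem quant_surjective (ε : ℝ) : Function.Surjective (quant ε) := by
  intro w
  obtain ⟨N, hN⟩ := exists_mem_wordsLT ε w
  rw [← map_quant] at hN
  obtain ⟨v, -, rfl⟩ := hN
  exact ⟨v, rfl⟩

theorem symPoly_linearIndependent (ε : ℝ) : LinearIndependent ℂ (symPoly ε) := by
  have h : LinearIndependent ℂ (fun M => quant ε (mon M)) :=
    (Finsupp.basisSingleOne (R := ℂ) (ι := Multiset Gen)).linearIndependent.map'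
      (quant ε) (LinearMap.ker_eq_bot.2 (quant_injective ε))
  have := h.units_smul (fun M => Units.mk0 (cnt M) (cnt_ne_zero M))
  convert this using 1
  funext M
  simp [quant_mon, smul_smul, cnt_ne_zero, Units.smul_def]

theorem symPoly_span (ε : ℝ) : ⊤ ≤ Submodule.span ℂ (Set.range (symPoly ε)) := by
  intro w _
  obtain ⟨v, rfl⟩ := quant_surjective ε w
  induction v using Finsupp.induction_linear with
  | zero => simp
  | add x y hx hy => rw [map_add]; exact add_mem (hx trivial) (hy trivial)
  | single M c =>
    rw [← mul_one c, ← smul_eq_mul, ← Finsupp.smul_single, map_smul, quant_mon, smul_smul]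
    exact Submodule.smul_mem _ _ (Submodule.subset_span ⟨M, rfl⟩)

/-- The basis of `𝒲(ε)` formed by the totally symmetric polynomials `S(s,t,u,v)`. -/
noncomputable def symPolyBasis (ε : ℝ) : Module.Basis (Multiset Gen) ℂ (W ε) :=
  Module.Basis.mk (symPoly_linearIndependent ε) (symPoly_span ε)

/-! ### The formal trace and its kernel -/

/-- The contribution of one word to the formal trace: the last two letters are removed if they are
`a₊a₋`, `a₋a₊`, `b₊b₋` or `b₋b₊`, and the contribution is zero otherwise. -/
noncomputable def trWord (ε : ℝ) (l : List Gen) : W ε :=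
  match l.reverse with
  | y :: x :: l' => if y = x.conj then word ε l'.reverse else 0
  | _ => 0

/-- The formal trace `tr : 𝒲 → 𝒲`: write an element as a totally symmetric polynomial and
collect the coefficients of `a₊a₋`, `a₋a₊`, `b₊b₋`, `b₋b₊` at the end of the words. -/
noncomputable def tr (ε : ℝ) : W ε →ₗ[ℂ] W ε :=
  (symPolyBasis ε).constr ℂ (fun M => ∑ l ∈ arrangements M, trWord ε l)

/-- The space `Ψ` of formally traceless symmetric polynomials. -/
noncomputable def Psi (ε : ℝ) : Submodule ℂ (W ε) := LinearMap.ker (tr ε)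

theorem tr_symPoly (ε : ℝ) (M : Multiset Gen) :
    tr ε (symPoly ε M) = ∑ l ∈ arrangements M, trWord ε l := by
  have : symPoly ε M = symPolyBasis ε M := by simp [symPolyBasis]
  rw [this, tr, Module.Basis.constr_basis]

theorem Gen.conj_conj (g : Gen) : g.conj.conj = g := by cases g <;> rfl

theorem sum_trWord (ε : ℝ) (M : Multiset Gen) (y : Gen) :
    ∑ l ∈ arrangements M, trWord ε (y :: l).reverse =
      if y.conj ∈ M then symPoly ε (M.erase y.conj) else 0 := by
  by_cases hM : M = 0
  · subst hM
    simp [arrangements_zero, trWord]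
  · rw [sum_arrangements hM]
    have : ∀ x ∈ M.toFinset, ∑ l ∈ arrangements (M.erase x), trWord ε (y :: x :: l).reverse =
        if x = y.conj then symPoly ε (M.erase x) else 0 := by
      intro x _
      have e : x = y.conj ↔ y = x.conj := by
        constructor <;> (rintro rfl; rw [Gen.conj_conj])
      simp only [trWord, List.reverse_reverse, e]
      split_ifs
      · rw [sum_arrangements_reverse (M.erase x) (word ε)]
        rfl
      · simp
    rw [Finset.sum_congr rfl this, Finset.sum_ite_eq']
    simp

/-- The formal trace of a totally symmetric polynomial:
`tr S(s,t,u,v) = 2 S(s-1,t-1,u,v) + 2 S(s,t,u-1,v-1)`. -/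
theorem tr_symPoly_eq (ε : ℝ) (M : Multiset Gen) :
    tr ε (symPoly ε M) = ∑ y ∈ M.toFinset,
      if y.conj ∈ M.erase y then symPoly ε ((M.erase y).erase y.conj) else 0 := by
  rw [tr_symPoly, ← sum_arrangements_reverse]
  by_cases hM : M = 0
  · subst hM
    simp [arrangements_zero, trWord]
  · rw [sum_arrangements hM]
    exact Finset.sum_congr rfl fun y _ => sum_trWord ε _ y

/-- The Laplacian on Weyl symbols. -/
noncomputable def lap : Symb →ₗ[ℂ] Symb := ∑ y, down y.conj ∘ₗ down y

/-- Multiplication by the (fourfold) symbol of `K₀`. -/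
noncomputable def quad : Symb →ₗ[ℂ] Symb := ∑ y, up y ∘ₗ up y.conj

/-- An invertible rescaling of the monomials. -/
noncomputable def scale : Symb →ₗ[ℂ] Symb :=
  Finsupp.linearCombination ℂ
    (fun M => (((M.card : ℂ) + 2) * ((M.card : ℂ) + 1))⁻¹ • mon M)

theorem scale_injective : Function.Injective scale := by
  have : (Finsupp.linearCombination ℂ
      (fun M : Multiset Gen => (((M.card : ℂ) + 2) * ((M.card : ℂ) + 1)) • mon M)) ∘ₗ scale =
      LinearMap.id := sym_ext fun M => by
    have h1 : (M.card : ℂ) + 2 ≠ 0 := by exact_mod_cast (by omega : M.card + 2 ≠ 0)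
    have h2 : (M.card : ℂ) + 1 ≠ 0 := by exact_mod_cast (by omega : M.card + 1 ≠ 0)
    simp only [scale, LinearMap.comp_apply, Finsupp.linearCombination_single, map_smul,
      smul_smul, LinearMap.id_apply, one_mul]
    rw [inv_mul_cancel₀ (mul_ne_zero h1 h2), one_smul]
  intro x y hxy
  rw [← LinearMap.id_apply (R := ℂ) x, ← LinearMap.id_apply (R := ℂ) y, ← this,
    LinearMap.comp_apply, LinearMap.comp_apply, hxy]

theorem tr_quant (ε : ℝ) (v : Symb) : tr ε (quant ε v) = quant ε (scale (lap v)) := by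
  have : tr ε ∘ₗ quant ε = quant ε ∘ₗ scale ∘ₗ lap := sym_ext fun M => by
    simp only [LinearMap.comp_apply, quant_mon, map_smul, tr_symPoly_eq, lap, LinearMap.sum_apply,
      map_sum, down_mon, Finset.smul_sum]
    rw [← Finset.sum_subset (Finset.subset_univ M.toFinset) (fun g _ hg => by
      rw [Multiset.count_eq_zero.2 (by simpa using hg), Nat.cast_zero, zero_smul])]
    refine Finset.sum_congr rfl fun y hy => ?_
    rw [Multiset.mem_toFinset] at hy
    split_ifs with h
    · have e1 := cnt_erase hy
      have e2 := cnt_erase h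
      have c1 := Multiset.card_erase_add_one hy
      have c2 := Multiset.card_erase_add_one h
      have c1' : (M.card : ℂ) = (((M.erase y).erase y.conj).card : ℂ) + 2 := by
        rw [← c1, ← c2]; push_cast; ring
      have c2' : ((M.erase y).card : ℂ) = (((M.erase y).erase y.conj).card : ℂ) + 1 := by
        rw [← c2]; push_cast; ring
      have h1 : (((M.erase y).erase y.conj).card : ℂ) + 2 ≠ 0 := by
        exact_mod_cast (by omega : ((M.erase y).erase y.conj).card + 2 ≠ 0)
      have h2 : (((M.erase y).erase y.conj).card : ℂ) + 1 ≠ 0 := by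
        exact_mod_cast (by omega : ((M.erase y).erase y.conj).card + 1 ≠ 0)
      rw [c1'] at e1
      rw [c2'] at e2
      simp only [scale, Finsupp.linearCombination_single, map_smul, quant_mon, smul_smul]
      congr 1
      have n1 := cnt_ne_zero M
      have n2 := cnt_ne_zero ((M.erase y).erase y.conj)
      field_simp
      linear_combination ((((M.erase y).erase y.conj).card : ℂ) + 2) * e2 +
        ((M.erase y).count y.conj : ℂ) * e1
    · rw [Multiset.count_eq_zero.2 h]
      simp
  exact LinearMap.congr_fun this v

theorem quant_mem_Psi (ε : ℝ) (v : Symb) : quant ε v ∈ Psi ε ↔ lap v = 0 := by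
  rw [Psi, LinearMap.mem_ker, tr_quant, map_eq_zero_iff _ (quant_injective ε),
    map_eq_zero_iff _ scale_injective]

theorem down_quad (y : Gen) (v : Symb) : down y (quad v) = quad (down y v) + (2 : ℂ) • up y.conj v := by
  simp only [quad, LinearMap.sum_apply, LinearMap.comp_apply, map_sum, down_up]
  cases y <;> simp only [Gen.sum_eq, Gen.conj, reduceCtorEq, if_true, if_false, map_add, map_zero] <;>
    module

theorem lap_quad (v : Symb) :
    lap (quad v) = quad (lap v) + (4 : ℂ) • ∑ y, up y (down y v) + (8 : ℂ) • v := by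
  simp only [lap, LinearMap.sum_apply, LinearMap.comp_apply, map_sum, down_quad, map_add, map_smul,
    down_up, if_true]
  simp only [Gen.sum_eq, Gen.conj]
  module

/-- The product of the factorials of the multiplicities. -/
def mfac (M : Multiset Gen) : ℝ := ∏ g, ((M.count g).factorial : ℝ)

theorem mfac_pos (M : Multiset Gen) : 0 < mfac M :=
  Finset.prod_pos fun _ _ => by exact_mod_cast Nat.factorial_pos _

theorem mfac_erase {M : Multiset Gen} {g : Gen} (hg : g ∈ M) :
    mfac M = M.count g * mfac (M.erase g) := by
  have hp := Multiset.count_pos.2 hg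
  have : ∀ h ∈ Finset.univ.erase g, ((M.count h).factorial : ℝ) =
      (((M.erase g).count h).factorial : ℝ) := by
    intro h hh
    rw [Multiset.count_erase_of_ne (Finset.ne_of_mem_erase hh)]
  rw [mfac, mfac, ← Finset.mul_prod_erase Finset.univ _ (Finset.mem_univ g),
    ← Finset.mul_prod_erase Finset.univ (fun h => (((M.erase g).count h).factorial : ℝ))
      (Finset.mem_univ g), Finset.prod_congr rfl this, Multiset.count_erase_self]
  obtain ⟨c, hc⟩ := Nat.exists_eq_succ_of_ne_zero hp.ne'
  rw [hc]
  simp only [Nat.succ_eq_add_one, Nat.factorial_succ, Nat.add_sub_cancel]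
  push_cast
  ring

/-- The Fischer form on symbols. -/
noncomputable def fischer (v w : Symb) : ℂ :=
  v.sum fun M c => (mfac M : ℂ) * starRingEnd ℂ c * w M

theorem fischer_single (M : Multiset Gen) (c : ℂ) (w : Symb) :
    fischer (Finsupp.single M c) w = (mfac M : ℂ) * starRingEnd ℂ c * w M := by
  simp [fischer]

theorem fischer_add_left (v v' w : Symb) : fischer (v + v') w = fischer v w + fischer v' w := by
  simp only [fischer]
  rw [Finsupp.sum_add_index'] <;> intros <;> simp; ring

theorem fischer_zero_left (w : Symb) : fischer 0 w = 0 := by simp [fischer]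

theorem fischer_add_right (v w w' : Symb) : fischer v (w + w') = fischer v w + fischer v w' := by
  simp [fischer, mul_add, Finsupp.sum_add]

theorem fischer_smul_right (c : ℂ) (v w : Symb) : fischer v (c • w) = c * fischer v w := by
  simp only [fischer, Finsupp.mul_sum, Finsupp.smul_apply, smul_eq_mul]
  congr 1
  funext M d
  ring

theorem up_apply (g : Gen) (w : Symb) (M : Multiset Gen) :
    up g w M = if g ∈ M then w (M.erase g) else 0 := by
  induction w using Finsupp.induction_linear with
  | zero => simp
  | add x y hx hy =>
    rw [map_add, Finsupp.add_apply, hx, hy]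
    split_ifs <;> simp
  | single M' c =>
    rw [← mul_one c, ← smul_eq_mul, ← Finsupp.smul_single, map_smul, up_mon]
    simp only [Finsupp.smul_apply, Finsupp.single_apply]
    by_cases hg : g ∈ M
    · rw [if_pos hg]
      congr 1
      refine if_congr ⟨?_, ?_⟩ rfl rfl
      · rintro rfl; simp
      · rintro rfl; exact Multiset.cons_erase hg
    · rw [if_neg hg, if_neg, smul_zero]
      rintro rfl
      simp at hg

theorem fischer_up (g : Gen) (v w : Symb) : fischer v (up g w) = fischer (down g v) w := by
  induction v using Finsupp.induction_linear with
  | zero => simp [fischer]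
  | add x y hx hy => rw [map_add, fischer_add_left, fischer_add_left, hx, hy]
  | single M c =>
    have : down g (Finsupp.single M c) = Finsupp.single (M.erase g) (c * M.count g) := by
      rw [← mul_one c, ← smul_eq_mul, ← Finsupp.smul_single, map_smul, down_mon]
      simp
    rw [this, fischer_single, fischer_single, up_apply]
    by_cases hg : g ∈ M
    · rw [if_pos hg, mfac_erase hg]
      simp only [map_mul, Complex.conj_natCast]
      push_cast
      ring
    · rw [if_neg hg, Multiset.count_eq_zero.2 hg]
      simp

theorem fischer_self (v : Symb) :
    fischer v v = ((v.sum fun M c => mfac M * ‖c‖ ^ 2 : ℝ) : ℂ) := by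
  simp only [fischer, Finsupp.sum]
  push_cast
  refine Finset.sum_congr rfl fun M _ => ?_
  rw [mul_assoc, Complex.conj_mul']

theorem fischer_self_nonneg (v : Symb) : 0 ≤ (fischer v v).re := by
  rw [fischer_self, Complex.ofReal_re]
  exact Finset.sum_nonneg fun M _ => mul_nonneg (mfac_pos M).le (sq_nonneg _)

theorem eq_zero_of_fischer_self {v : Symb} (h : (fischer v v).re ≤ 0) : v = 0 := by
  rw [fischer_self, Complex.ofReal_re] at h
  have h0 : v.sum (fun M c => mfac M * ‖c‖ ^ 2) = 0 := le_antisymm h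
    (Finset.sum_nonneg fun M _ => mul_nonneg (mfac_pos M).le (sq_nonneg _))
  rw [Finsupp.sum, Finset.sum_eq_zero_iff_of_nonneg
    (fun M _ => mul_nonneg (mfac_pos M).le (sq_nonneg _))] at h0
  ext M
  by_contra hM
  have := h0 M (Finsupp.mem_support_iff.2 hM)
  rw [mul_eq_zero] at this
  rcases this with h | h
  · exact (mfac_pos M).ne' h
  · exact hM (by simpa using h)

theorem eq_zero_of_fischer_lap_quad {v : Symb} (h : fischer v (lap (quad v)) = 0) : v = 0 := by
  have e : ∀ w, fischer v (quad w) = fischer (lap v) w := by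
    intro w
    simp only [quad, lap, Gen.sum_eq, LinearMap.add_apply, LinearMap.comp_apply, fischer_add_left,
      fischer_add_right, fischer_up]
  rw [lap_quad, fischer_add_right, fischer_add_right, fischer_smul_right, fischer_smul_right, e]
    at h
  simp only [Gen.sum_eq, fischer_add_right, fischer_up] at h
  have h' := congrArg Complex.re h
  simp only [Complex.add_re, Complex.mul_re, Complex.re_ofNat, Complex.im_ofNat, zero_mul,
    sub_zero, Complex.zero_re] at h'
  have p0 := fischer_self_nonneg (lap v)
  have p1 := fischer_self_nonneg (down .aP v)
  have p2 := fischer_self_nonneg (down .aM v)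
  have p3 := fischer_self_nonneg (down .bP v)
  have p4 := fischer_self_nonneg (down .bM v)
  exact eq_zero_of_fischer_self (by linarith)

theorem lap_mem {N : ℕ} {v : Symb} (h : v ∈ symLT (N + 2)) : lap v ∈ symLT N := by
  have : symLT (N + 2) ≤ (symLT N).comap lap := symLT_le fun M hM => by
    simp only [Submodule.mem_comap, lap, LinearMap.sum_apply, LinearMap.comp_apply, down_mon,
      map_smul]
    refine Submodule.sum_mem _ fun y _ => ?_
    by_cases h1 : y ∈ M
    · by_cases h2 : y.conj ∈ M.erase y
      · refine Submodule.smul_mem _ _ (Submodule.smul_mem _ _ (mon_mem ?_))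
        have := Multiset.card_erase_add_one h1
        have := Multiset.card_erase_add_one h2
        omega
      · rw [Multiset.count_eq_zero.2 h2]; simp
    · rw [Multiset.count_eq_zero.2 h1]; simp
  exact this h

theorem quad_mem {N : ℕ} {v : Symb} (h : v ∈ symLT N) : quad v ∈ symLT (N + 2) := by
  have : symLT N ≤ (symLT (N + 2)).comap quad := symLT_le fun M hM => by
    simp only [Submodule.mem_comap, quad, LinearMap.sum_apply, LinearMap.comp_apply, up_mon]
    exact Submodule.sum_mem _ fun y _ => mon_mem (by simpa using hM)
  exact this h

theorem mem_symLT_of_lap_quad {N : ℕ} {v : Symb} (hv : v ∈ symLT (N + 1))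
    (h : lap (quad v) ∈ symLT N) : v ∈ symLT N := by
  set v' := v.filter (fun M => M.card = N) with hv'
  have h1 : v - v' ∈ symLT N := by
    rw [symLT, Finsupp.mem_supported']
    intro M hM
    simp only [Set.mem_ofPred_eq, not_lt] at hM
    rw [Finsupp.sub_apply, hv', Finsupp.filter_apply]
    split_ifs with e
    · simp
    · rw [symLT, Finsupp.mem_supported'] at hv
      rw [hv M (by simp only [Set.mem_ofPred_eq]; omega), sub_zero]
  have h2 : lap (quad v') ∈ symLT N := by
    have := sub_mem h (lap_mem (quad_mem h1))
    rwa [map_sub, map_sub, sub_sub_cancel] at this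
  have h3 : v' = 0 := by
    apply eq_zero_of_fischer_lap_quad
    rw [fischer]
    refine Finset.sum_eq_zero fun M hM => ?_
    have hc : M.card = N := by
      by_contra hne
      rw [Finsupp.mem_support_iff, hv', Finsupp.filter_apply, if_neg hne] at hM
      exact hM rfl
    rw [symLT, Finsupp.mem_supported'] at h2
    change _ * lap (quad v') M = 0
    rw [h2 M (by simp [hc]), mul_zero]
  rwa [h3, sub_zero] at h1

theorem finite_card_lt (N : ℕ) : {M : Multiset Gen | M.card < N}.Finite := by
  have h : {M : Multiset Gen | M.card < N} ⊆
      ⋃ n ∈ Finset.range N, Set.range (fun s : _root_.Sym Gen n => s.1) := by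
    intro M hM
    rw [Set.mem_iUnion₂]
    exact ⟨M.card, Finset.mem_range.2 hM, Set.mem_range.2 ⟨⟨M, rfl⟩, rfl⟩⟩
  exact (Set.Finite.biUnion (Finset.finite_toSet _) fun n _ => Set.finite_range _).subset h

theorem finiteDimensional_symLT (N : ℕ) : FiniteDimensional ℂ (symLT N) := by
  rw [symLT, Finsupp.supported_eq_span_single]
  exact FiniteDimensional.span_of_finite ℂ ((finite_card_lt N).image _)

theorem exists_preimage {V : Type*} [AddCommGroup V] [Module ℂ V] (P : Submodule ℂ V)
    [FiniteDimensional ℂ P] (f : V →ₗ[ℂ] V) (h : ∀ v ∈ P, f v ∈ P)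
    (hi : ∀ v, f v = 0 → v = 0) {w : V} (hw : w ∈ P) : ∃ v ∈ P, f v = w := by
  have hf : Function.Injective (f.restrict h) := by
    rw [injective_iff_map_eq_zero]
    intro v hv
    exact Subtype.ext (hi v (congrArg Subtype.val hv))
  obtain ⟨v, hv⟩ := LinearMap.injective_iff_surjective.1 hf ⟨w, hw⟩
  exact ⟨v, v.2, congrArg Subtype.val hv⟩

theorem exists_lap_quad {N : ℕ} {w : Symb} (hw : w ∈ symLT N) :
    ∃ v, v ∈ symLT N ∧ lap (quad v) = w := by
  have := finiteDimensional_symLT N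
  obtain ⟨v, h1, h2⟩ := exists_preimage (symLT N) (lap ∘ₗ quad)
    (fun v hv => by
      rw [LinearMap.comp_apply]
      exact lap_mem (quad_mem hv))
    (fun v hv => eq_zero_of_fischer_lap_quad (by
      rw [LinearMap.comp_apply] at hv
      rw [hv]
      exact Finset.sum_eq_zero fun M _ => by simp)) hw
  rw [LinearMap.comp_apply] at h2
  exact ⟨v, h1, h2⟩

/-- `K₀ = ½ (a₊a₋ + b₊b₋ + ε)`. -/
noncomputable def K₀ (ε : ℝ) : W ε :=
  (1 / 2 : ℂ) • (gen ε .aP * gen ε .aM + gen ε .bP * gen ε .bM + algebraMap ℂ (W ε) ε)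

/-- The left ideal `{ w (K₀ - R̂) | w ∈ 𝒲 }`. -/
noncomputable def leftIdeal (ε Rhat : ℝ) : Submodule ℂ (W ε) :=
  LinearMap.range (LinearMap.mulRight ℂ (K₀ ε - algebraMap ℂ (W ε) Rhat))

theorem four_K₀ (ε : ℝ) : (4 : ℂ) • K₀ ε = ∑ y : Gen, word ε [y, y.conj] := by
  have h1 := gen_mul_gen ε .aM .aP
  have h2 := gen_mul_gen ε .bM .bP
  simp only [Gen.comm] at h1 h2
  simp only [Gen.sum_eq, word, Gen.conj, List.map_cons, List.map_nil, List.prod_cons,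
    List.prod_nil, mul_one, h1, h2, K₀]
  module

theorem quant_quad_sub_mem (ε Rhat : ℝ) {N : ℕ} {v : Symb} (hv : v ∈ symLT N) :
    quant ε (quad v) - (4 : ℂ) • (quant ε v * (K₀ ε - algebraMap ℂ (W ε) Rhat)) ∈
      wordsLT ε (N + 1) := by
  have key : symLT N ≤ (wordsLT ε (N + 1)).comap (quant ε ∘ₗ quad - (4 : ℂ) •
      (LinearMap.mulRight ℂ (K₀ ε - algebraMap ℂ (W ε) Rhat) ∘ₗ quant ε)) := symLT_le fun M hM => by
    induction M using Quotient.inductionOn with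
    | h l =>
    change mon (l : Multiset Gen) ∈ _
    have hl : l.length < N := hM
    have hq := quant_sub_word_mem ε l
    have e : quant ε (quad (mon (l : Multiset Gen))) - (4 : ℂ) •
        (quant ε (mon (l : Multiset Gen)) * (K₀ ε - algebraMap ℂ (W ε) Rhat)) =
        ∑ y : Gen, (quant ε (mon ((y :: y.conj :: l : List Gen) : Multiset Gen)) -
            word ε (y :: y.conj :: l) + (word ε (y :: y.conj :: l) - word ε (l ++ [y, y.conj])) -
          (quant ε (mon (l : Multiset Gen)) - word ε l) * word ε [y, y.conj]) +
        (4 * (Rhat : ℂ)) • quant ε (mon (l : Multiset Gen)) := by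
      rw [mul_sub, smul_sub, ← mul_smul_comm, four_K₀, ← Algebra.commutes, ← Algebra.smul_def,
        smul_smul, Finset.mul_sum]
      simp only [quad, LinearMap.sum_apply, LinearMap.comp_apply, up_mon, Multiset.cons_coe,
        map_sum, word_append, sub_mul]
      simp only [Gen.sum_eq]
      module
    simp only [Submodule.mem_comap, LinearMap.sub_apply, LinearMap.comp_apply,
      LinearMap.smul_apply, LinearMap.mulRight_apply]
    rw [e]
    refine add_mem (Submodule.sum_mem _ fun y _ => sub_mem (add_mem ?_ ?_) ?_)
      (Submodule.smul_mem _ _ ?_)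
    · exact wordsLT_mono ε (by simp only [List.length_cons]; omega) (quant_sub_word_mem ε _)
    · refine wordsLT_mono ε ?_ (word_sub_mem ε (l' := l ++ [y, y.conj])
        (List.perm_append_comm (l₁ := [y, y.conj]) (l₂ := l)))
      simp only [List.length_cons]; omega
    · exact wordsLT_mono ε (by simp only [List.length_cons, List.length_nil]; omega)
        (mul_word_mem ε [y, y.conj] hq)
    · rw [← sub_add_cancel (quant ε (mon (l : Multiset Gen))) (word ε l)]
      exact add_mem (wordsLT_mono ε (by omega) hq) (word_mem ε (by omega))
  exact key hv

theorem isCompl_Psi_leftIdeal (ε Rhat : ℝ) : IsCompl (Psi ε) (leftIdeal ε Rhat) := by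
  constructor
  · rw [Submodule.disjoint_def]
    rintro w hw ⟨u, rfl⟩
    obtain ⟨h, hh⟩ := quant_surjective ε
      (LinearMap.mulRight ℂ (K₀ ε - algebraMap ℂ (W ε) Rhat) u)
    rw [← hh, quant_mem_Psi] at hw
    obtain ⟨v, rfl⟩ := quant_surjective ε u
    rw [LinearMap.mulRight_apply] at hh ⊢
    have step : ∀ N, v ∈ symLT (N + 1) → v ∈ symLT N := by
      intro N hv
      apply mem_symLT_of_lap_quad hv
      have h1 := quant_quad_sub_mem ε Rhat hv
      rw [← hh, ← map_smul, ← map_sub, ← map_quant] at h1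
      obtain ⟨x, hx, e⟩ := h1
      rw [quant_injective ε e] at hx
      have := lap_mem hx
      rwa [map_sub, map_smul, hw, smul_zero, sub_zero] at this
    have all : ∀ N, v ∈ symLT N → v = 0 := by
      intro N
      induction N with
      | zero =>
        intro hv
        ext M
        rw [symLT, Finsupp.mem_supported'] at hv
        exact hv M (by simp)
      | succ N ih => exact fun hv => ih (step N hv)
    obtain ⟨N, hN⟩ := exists_mem_wordsLT ε (quant ε v)
    rw [← map_quant] at hN
    obtain ⟨x, hx, e⟩ := hN
    rw [quant_injective ε e] at hx
    rw [all N hx]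
    simp
  · rw [codisjoint_iff_le_sup]
    have key : ∀ N, (symLT N).map (quant ε) ≤ Psi ε ⊔ leftIdeal ε Rhat := by
      intro N
      induction N with
      | zero =>
        rw [Submodule.map_le_iff_le_comap]
        exact symLT_le fun M hM => absurd hM (Nat.not_lt_zero _)
      | succ N ih =>
        rw [Submodule.map_le_iff_le_comap]
        intro q hq
        rw [Submodule.mem_comap]
        cases N with
        | zero =>
          refine Submodule.mem_sup_left ((quant_mem_Psi ε q).2 ?_)
          have := lap_mem (N := 0) (symLT_mono (by omega) hq)
          ext M
          rw [symLT, Finsupp.mem_supported'] at this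
          exact this M (by simp)
        | succ N =>
          obtain ⟨p, hp, e⟩ := exists_lap_quad (lap_mem hq)
          have h1 := quant_quad_sub_mem ε Rhat hp
          rw [← map_quant] at h1
          have h2 : quant ε (q - quad p) ∈ Psi ε := by
            rw [quant_mem_Psi, map_sub, e, sub_self]
          have h3 : (4 : ℂ) • (quant ε p * (K₀ ε - algebraMap ℂ (W ε) Rhat)) ∈
              leftIdeal ε Rhat := Submodule.smul_mem _ _ ⟨quant ε p, rfl⟩
          have h4 := add_mem (add_mem (ih h1) (Submodule.mem_sup_right h3))
            (Submodule.mem_sup_left h2)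
          rwa [sub_add_cancel, map_sub, add_sub_cancel] at h4
    intro w _
    obtain ⟨N, hN⟩ := exists_mem_wordsLT ε w
    rw [← map_quant] at hN
    exact key N hN

/-- `R̂ = (R² + ¼ ε²)^½`. -/
noncomputable def Rhat (ε R : ℝ) : ℝ := √(R ^ 2 + ε ^ 2 / 4)

/-- The projection `ρ = ρ_R : 𝒲 → Ψ` with kernel `{ w (K₀ - R̂) | w ∈ 𝒲 }`. -/
noncomputable def rho (ε R : ℝ) : W ε →ₗ[ℂ] Psi ε :=
  Submodule.projectionOnto (Psi ε) (leftIdeal ε (Rhat ε R)) (isCompl_Psi_leftIdeal ε (Rhat ε R))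

/-- `Ad_T w = [T, w]`. -/
noncomputable def ad {ε : ℝ} (T : W ε) : W ε →ₗ[ℂ] W ε :=
  LinearMap.mulLeft ℂ T - LinearMap.mulRight ℂ T

/-- The eigenspace `Ψ_r = { ξ ∈ Ψ | [K₀, ξ] = ε r ξ }`, where `r = twoR / 2`. -/
noncomputable def PsiR (ε : ℝ) (twoR : ℤ) : Submodule ℂ (W ε) :=
  Psi ε ⊓ LinearMap.ker (ad (K₀ ε) - ((ε : ℂ) * ((twoR : ℂ) / 2)) • LinearMap.id)

/-- `J₋ = a₋ b₊`. -/
noncomputable def Jminus (ε : ℝ) : W ε := gen ε .aM * gen ε .bP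

/-- The basis element
`P(n,r,m) = ε^(m-n) ((n+m)! / ((2n)! (n-m)!))^½ (Ad_{J₋})^(n-m) (a₊^(n+r) b₋^(n-r))`,
for `n = twoN / 2`, `r = twoR / 2`, `m = twoM / 2` with `|r| ≤ n`, `|m| ≤ n` and `n + r`, `n + m`
integers (so that all the divisions by two below are exact and nonnegative). -/
noncomputable def basisP (ε : ℝ) (twoN : ℕ) (twoR twoM : ℤ) : W ε :=
  let nAddM := ((twoN + twoM) / 2).toNat
  let nSubM := ((twoN - twoM) / 2).toNat
  let nAddR := ((twoN + twoR) / 2).toNat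
  let nSubR := ((twoN - twoR) / 2).toNat
  (((ε ^ nSubM)⁻¹ *
      √((nAddM.factorial : ℝ) / ((twoN.factorial : ℝ) * (nSubM.factorial : ℝ))) : ℝ) : ℂ) •
    (ad (Jminus ε) ^ nSubM) (gen ε .aP ^ nAddR * gen ε .bM ^ nSubR)

/-! ### The Fock representation -/

/-- The labels `(2k, 2j)` of the Fock basis `|k,j⟩`: `2k` and `k + j` are integers, `|j| ≤ k`
(so `k ≥ 0`). -/
abbrev FockLabel : Type := {p : ℤ × ℤ // |p.2| ≤ p.1 ∧ Even (p.1 + p.2)}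

/-- The dense space of finite linear combinations of the orthonormal basis `|k,j⟩` of the
Fock space, on which `𝒲(ε)` acts. -/
abbrev Fock : Type := FockLabel →₀ ℂ

open Classical in
/-- The vector `|k,j⟩` with `k = K / 2`, `j = J / 2` (zero if there is no such label). -/
noncomputable def ket (K J : ℤ) : Fock :=
  if h : |J| ≤ K ∧ Even (K + J) then Finsupp.single ⟨(K, J), h⟩ 1 else 0

open Classical in
/-- The dual vector `⟨k,j|` with `k = K / 2`, `j = J / 2`: the coefficient at `|k,j⟩`. -/
noncomputable def bra (K J : ℤ) : Fock →ₗ[ℂ] ℂ :=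
  if h : |J| ≤ K ∧ Even (K + J) then Finsupp.lapply ⟨(K, J), h⟩ else 0

/-- The factor `(k+j+1)^½`, `(k+j)^½`, `(k-j+1)^½`, `(k-j)^½` in the action of
`a₊`, `a₋`, `b₊`, `b₋` on `|k,j⟩`, where `k = K / 2`, `j = J / 2`. -/
noncomputable def amp : Gen → ℤ → ℤ → ℝ
  | .aP, K, J => √((K : ℝ) / 2 + (J : ℝ) / 2 + 1)
  | .aM, K, J => √((K : ℝ) / 2 + (J : ℝ) / 2)
  | .bP, K, J => √((K : ℝ) / 2 - (J : ℝ) / 2 + 1)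
  | .bM, K, J => √((K : ℝ) / 2 - (J : ℝ) / 2)

/-- The change of `2k` under a generator. -/
def shiftK : Gen → ℤ
  | .aP => 1
  | .aM => -1
  | .bP => 1
  | .bM => -1

/-- The change of `2j` under a generator. -/
def shiftJ : Gen → ℤ
  | .aP => 1
  | .aM => -1
  | .bP => -1
  | .bM => 1

/-- The action of the generators:
`a₊|k,j⟩ = ε^½ (k+j+1)^½ |k+½,j+½⟩`, `a₋|k,j⟩ = ε^½ (k+j)^½ |k-½,j-½⟩`,
`b₊|k,j⟩ = ε^½ (k-j+1)^½ |k+½,j-½⟩`, `b₋|k,j⟩ = ε^½ (k-j)^½ |k-½,j+½⟩`. -/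
noncomputable def fockOp (ε : ℝ) (g : Gen) : Module.End ℂ Fock :=
  Finsupp.linearCombination ℂ (fun p : FockLabel =>
    ((√ε * amp g p.1.1 p.1.2 : ℝ) : ℂ) • ket (p.1.1 + shiftK g) (p.1.2 + shiftJ g))

theorem fockOp_ket (ε : ℝ) (g : Gen) {K J : ℤ} (h : |J| ≤ K ∧ Even (K + J)) :
    fockOp ε g (ket K J) = ((√ε * amp g K J : ℝ) : ℂ) • ket (K + shiftK g) (J + shiftJ g) := by
  rw [ket, dif_pos h, fockOp, Finsupp.linearCombination_single, one_smul]

theorem amp_eq_zero (g : Gen) {K J : ℤ} (h : |J| ≤ K ∧ Even (K + J))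
    (h' : ¬ (|J + shiftJ g| ≤ K + shiftK g ∧ Even (K + shiftK g + (J + shiftJ g)))) :
    amp g K J = 0 := by
  obtain ⟨h1, c, hc⟩ := h
  rw [abs_le] at h1 h'
  have e : Even (K + shiftK g + (J + shiftJ g)) := by
    cases g <;> simp only [shiftK, shiftJ]
    · exact ⟨c + 1, by omega⟩
    · exact ⟨c - 1, by omega⟩
    · exact ⟨c, by omega⟩
    · exact ⟨c, by omega⟩
  cases g <;> simp only [shiftK, shiftJ, amp] at h' e ⊢
  · exact absurd ⟨⟨by omega, by omega⟩, e⟩ h'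
  · have : K = -J := by
      by_contra hne
      exact h' ⟨⟨by omega, by omega⟩, e⟩
    rw [this]; push_cast
    rw [show -(J : ℝ) / 2 + (J : ℝ) / 2 = 0 by ring, Real.sqrt_zero]
  · exact absurd ⟨⟨by omega, by omega⟩, e⟩ h'
  · have : K = J := by
      by_contra hne
      exact h' ⟨⟨by omega, by omega⟩, e⟩
    rw [this, sub_self, Real.sqrt_zero]

theorem fockOp_fockOp_ket {ε : ℝ} (hε : 0 ≤ ε) (g h : Gen) {K J : ℤ}
    (hKJ : |J| ≤ K ∧ Even (K + J)) :
    fockOp ε g (fockOp ε h (ket K J)) =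
      ((ε * (amp h K J * amp g (K + shiftK h) (J + shiftJ h)) : ℝ) : ℂ) •
        ket (K + shiftK h + shiftK g) (J + shiftJ h + shiftJ g) := by
  rw [fockOp_ket ε h hKJ, map_smul]
  by_cases h' : |J + shiftJ h| ≤ K + shiftK h ∧ Even (K + shiftK h + (J + shiftJ h))
  · rw [fockOp_ket ε g h', smul_smul, ← Complex.ofReal_mul]
    congr 2
    linear_combination (amp h K J * amp g (K + shiftK h) (J + shiftJ h)) * Real.mul_self_sqrt hε
  · rw [amp_eq_zero h hKJ h']
    simp

theorem amp_comm (g h : Gen) {K J : ℤ} (hKJ : |J| ≤ K ∧ Even (K + J)) (ε : ℝ) :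
    ((ε * (amp h K J * amp g (K + shiftK h) (J + shiftJ h)) : ℝ) : ℂ) =
      ((ε * (amp g K J * amp h (K + shiftK g) (J + shiftJ g)) : ℝ) : ℂ) + Gen.comm ε g h := by
  have h1 : (0 : ℝ) ≤ (K : ℝ) / 2 + (J : ℝ) / 2 := by
    have : (0 : ℝ) ≤ ((K + J : ℤ) : ℝ) := by
      exact_mod_cast (by have := (abs_le.1 hKJ.1).1; omega)
    push_cast at this; linarith
  have h2 : (0 : ℝ) ≤ (K : ℝ) / 2 - (J : ℝ) / 2 := by
    have : (0 : ℝ) ≤ ((K - J : ℤ) : ℝ) := by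
      exact_mod_cast (by have := (abs_le.1 hKJ.1).2; omega)
    push_cast at this; linarith
  have s1 := congrArg Complex.ofReal (Real.mul_self_sqrt h1)
  have s2 := congrArg Complex.ofReal (Real.mul_self_sqrt h2)
  have s3 := congrArg Complex.ofReal (Real.mul_self_sqrt (add_nonneg h1 zero_le_one))
  have s4 := congrArg Complex.ofReal (Real.mul_self_sqrt (add_nonneg h2 zero_le_one))
  push_cast at s1 s2 s3 s4
  have n1 : ((K : ℝ) + -1) / 2 + ((J : ℝ) + -1) / 2 + 1 = (K : ℝ) / 2 + (J : ℝ) / 2 := by ring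
  have n2 : ((K : ℝ) + 1) / 2 + ((J : ℝ) + 1) / 2 = (K : ℝ) / 2 + (J : ℝ) / 2 + 1 := by ring
  have n3 : ((K : ℝ) + -1) / 2 - ((J : ℝ) + 1) / 2 + 1 = (K : ℝ) / 2 - (J : ℝ) / 2 := by ring
  have n4 : ((K : ℝ) + 1) / 2 - ((J : ℝ) + -1) / 2 = (K : ℝ) / 2 - (J : ℝ) / 2 + 1 := by ring
  have n5 : ((K : ℝ) + 1) / 2 - ((J : ℝ) + 1) / 2 = (K : ℝ) / 2 - (J : ℝ) / 2 := by ring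
  have n6 : ((K : ℝ) + -1) / 2 - ((J : ℝ) + -1) / 2 = (K : ℝ) / 2 - (J : ℝ) / 2 := by ring
  have n7 : ((K : ℝ) + 1) / 2 + ((J : ℝ) + -1) / 2 = (K : ℝ) / 2 + (J : ℝ) / 2 := by ring
  have n8 : ((K : ℝ) + -1) / 2 + ((J : ℝ) + 1) / 2 = (K : ℝ) / 2 + (J : ℝ) / 2 := by ring
  cases g <;> cases h <;> simp only [Gen.comm, amp, shiftK, shiftJ] <;> push_cast <;>
    simp only [n1, n2, n3, n4, n5, n6, n7, n8, add_zero] <;>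
    first
    | ring1
    | linear_combination (ε : ℂ) * (s1 - s3)
    | linear_combination (ε : ℂ) * (s3 - s1)
    | linear_combination (ε : ℂ) * (s2 - s4)
    | linear_combination (ε : ℂ) * (s4 - s2)

theorem fock_ext {f g : Module.End ℂ Fock}
    (h : ∀ K J : ℤ, |J| ≤ K ∧ Even (K + J) → f (ket K J) = g (ket K J)) : f = g := by
  refine Finsupp.lhom_ext' fun p => LinearMap.ext_ring ?_
  obtain ⟨⟨K, J⟩, hp⟩ := p
  have := h K J hp
  rwa [ket, dif_pos hp] at this

theorem fockOp_comm {ε : ℝ} (hε : 0 ≤ ε) (g h : Gen) :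
    fockOp ε g * fockOp ε h =
      fockOp ε h * fockOp ε g + algebraMap ℂ (Module.End ℂ Fock) (Gen.comm ε g h) := by
  apply fock_ext
  intro K J hKJ
  simp only [Module.End.mul_apply, LinearMap.add_apply, Module.algebraMap_end_apply,
    fockOp_fockOp_ket hε _ _ hKJ, amp_comm g h hKJ ε, add_smul, add_right_comm K (shiftK h),
    add_right_comm J (shiftJ h)]
  congr 1
  cases g <;> cases h <;> simp [Gen.comm, shiftK, shiftJ]

/-- The Fock representation of `𝒲(ε)`. -/
noncomputable def fockRep {ε : ℝ} (hε : 0 < ε) : W ε →ₐ[ℂ] Module.End ℂ Fock :=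
  W.lift ε (fockOp ε) (fockOp_comm hε.le)

/-- The map `φ^r_k : Ψ_r → M_{(2k+2r+1)×(2k+1)}(ℂ)`, where `k = twoK / 2`, `r = twoR / 2` and
`D = 2k + 2r + 1` is the number of rows. With row and column indices counted from zero,
the `(μ, ν)` entry of `φ^r_k(ξ)` is `⟨k + r, μ - k - r| ξ |k, ν - k⟩`. -/
noncomputable def phi {ε : ℝ} (hε : 0 < ε) (D twoK : ℕ) (twoR : ℤ) :
    PsiR ε twoR →ₗ[ℂ] Matrix (Fin D) (Fin (twoK + 1)) ℂ where
  toFun ξ := Matrix.of fun μ ν =>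
    bra (twoK + twoR) (2 * (μ : ℤ) - (twoK + twoR))
      (fockRep hε (ξ : W ε) (ket twoK (2 * (ν : ℤ) - twoK)))
  map_add' ξ ζ := by
    ext μ ν
    simp
  map_smul' c ξ := by
    ext μ ν
    simp

end NCSphere

namespace NCSphere

/-! ### The symbol calculus -/

/-! The analytic core is that `K₀` acts on the level of Fock space with label `k` as the scalar `ε(k
+ ½)`. The hypothesis on `R̂` says precisely that `K₀ - R̂` kills this level. Since `w - ρ(w)` is a
left multiple of `K₀ - R̂`, the elements `w` and `ρ(w)` act identically there (`fockRep_rho`), so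
the projection can be dropped from every matrix element taken on level `k`.

An element of weight `r` under `Ad K₀` carries level `k` into level `k + r`
(`fockRep_mem_fockLevel`), and the kets of one level are a finite basis of it (`eq_sum_ket`). Claim
1 is then composition of operators with this basis inserted between the factors. Claim 2 is the same
argument once `†` is known to be the adjoint for the Fock inner product (`fockForm_fockRep`): a
matrix element of `ξ†ζ` is an inner product of two vectors of level `k + r`.

For claim 3, each `b₋` lowers `k - j` by one, and `k - j ≤ 2k`. Hence `a₊^(n+r) b₋^(n-r)` kills
level `k` as soon as `n - r > 2k`. Since `J₋` preserves the level, commutators with `J₋` inherit the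
vanishing (`fockRep_ad_Jminus_pow_eq_zero`).

The memberships in `Ψ_r` are algebraic. In Weyl symbols, formally traceless means harmonic, and `Ad`
of a quadratic element is a first-order differential operator. Those of `K₀` and `J₋` preserve
harmonicity. As `Ad K₀` also preserves the left ideal generated by `K₀ - R̂`, it is compatible with
the splitting of `𝒲` into `Ψ` and that ideal, so `ρ` preserves weights (`rho_mem_PsiR`). -/

theorem W.induction {ε : ℝ} {p : W ε → Prop} (algebraMap : ∀ c, p (algebraMap ℂ (W ε) c))
    (gen : ∀ g, p (gen ε g)) (mul : ∀ v w, p v → p w → p (v * w))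
    (add : ∀ v w, p v → p w → p (v + w)) (w : W ε) : p w := by
  obtain ⟨x, rfl⟩ := RingQuot.mkAlgHom_surjective ℂ (Rel ε) w
  induction x using FreeAlgebra.induction with
  | grade0 c =>
    rw [AlgHom.commutes]
    exact algebraMap c
  | grade1 g => exact gen g
  | mul x y hx hy => rw [map_mul]; exact mul _ _ hx hy
  | add x y hx hy => rw [map_add]; exact add _ _ hx hy

/-- The Weyl symbol of an element of `𝒲(ε)`. -/
noncomputable def symb (ε : ℝ) : W ε →ₗ[ℂ] Symb :=
  LinearMap.applyₗ (mon 0) ∘ₗ (symAction ε).toLinearMap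

theorem symb_apply (ε : ℝ) (w : W ε) : symb ε w = symAction ε w (mon 0) := rfl

theorem quant_symb (ε : ℝ) (w : W ε) : quant ε (symb ε w) = w := by
  obtain ⟨v, rfl⟩ := quant_surjective ε w
  rw [symb_apply, symAction_quant]

theorem symb_one (ε : ℝ) : symb ε 1 = mon 0 := by
  rw [symb_apply, map_one, Module.End.one_apply]

/-- The working description of `Ψ`: formally traceless elements are those with harmonic Weyl symbol.
-/
theorem mem_Psi_iff {ε : ℝ} {w : W ε} : w ∈ Psi ε ↔ lap (symb ε w) = 0 := by
  rw [← quant_mem_Psi ε, quant_symb]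

theorem symb_gen_mul (ε : ℝ) (g : Gen) (w : W ε) :
    symb ε (gen ε g * w) = leftOp ε g (symb ε w) := by
  rw [symb_apply, map_mul, Module.End.mul_apply, symAction, W.lift_gen]
  rfl

/-- Right multiplication by a letter, on Weyl symbols. -/
noncomputable def rightOp (ε : ℝ) (g : Gen) : Module.End ℂ Symb :=
  up g - (Gen.comm ε g g.conj / 2) • down g.conj

/-- The contraction terms of the two orders agree because exchanging conjugate letters changes the
sign of their commutator, while `rightOp` carries the opposite sign to `leftOp`. -/
theorem leftOp_rightOp (ε : ℝ) (g h : Gen) (v : Symb) :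
    leftOp ε g (rightOp ε h v) = rightOp ε h (leftOp ε g v) := by
  simp only [leftOp, rightOp, LinearMap.add_apply, LinearMap.sub_apply, LinearMap.smul_apply,
    map_add, map_sub, map_smul, down_up, smul_add, up_up h g, down_down h.conj g.conj]
  cases g <;> cases h <;>
    simp only [Gen.conj, Gen.comm, reduceCtorEq, if_true, if_false] <;> module

theorem symAction_rightOp (ε : ℝ) (g : Gen) (w : W ε) (v : Symb) :
    symAction ε w (rightOp ε g v) = rightOp ε g (symAction ε w v) := by
  induction w using W.induction generalizing v with
  | algebraMap c => simp [AlgHom.commutes, Module.algebraMap_end_apply]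
  | gen h => rw [symAction, W.lift_gen, leftOp_rightOp]
  | mul x y hx hy => simp only [map_mul, Module.End.mul_apply, hx, hy]
  | add x y hx hy => simp only [map_add, LinearMap.add_apply, hx, hy]

/-- On the constant symbol the derivative terms vanish, so `leftOp` and `rightOp` agree there. The
right operator then passes through the action of `w`, with which it commutes. -/
theorem symb_mul_gen (ε : ℝ) (g : Gen) (w : W ε) :
    symb ε (w * gen ε g) = rightOp ε g (symb ε w) := by
  have h : symAction ε (gen ε g) (mon 0) = rightOp ε g (mon 0) := by
    rw [symAction, W.lift_gen]
    simp [leftOp, rightOp]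
  rw [symb_apply, map_mul, Module.End.mul_apply, h, symAction_rightOp]
  rfl

/-! ### The adjoint action of quadratic elements on symbols -/

theorem ad_apply {ε : ℝ} (T w : W ε) : ad T w = T * w - w * T := rfl

theorem ad_mul {ε : ℝ} (T v w : W ε) : ad T (v * w) = ad T v * w + v * ad T w := by
  simp only [ad_apply]
  noncomm_ring

/-- For a quadratic element the Moyal bracket reduces to the Poisson bracket: in the difference of
left and right multiplication the terms with two multiplications, those with two derivatives and the
ordering constants cancel. -/
theorem symb_ad_gen_mul_gen (ε : ℝ) (g h : Gen) (w : W ε) :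
    symb ε (ad (gen ε g * gen ε h) w) =
      Gen.comm ε g g.conj • up h (down g.conj (symb ε w)) +
        Gen.comm ε h h.conj • up g (down h.conj (symb ε w)) := by
  rw [ad_apply, map_sub, mul_assoc, ← mul_assoc w, symb_gen_mul, symb_gen_mul, symb_mul_gen,
    symb_mul_gen]
  simp only [leftOp, rightOp, LinearMap.add_apply, LinearMap.sub_apply, LinearMap.smul_apply,
    map_add, map_sub, map_smul, down_up, smul_add, up_up h g, down_down h.conj g.conj]
  cases g <;> cases h <;>
    simp only [Gen.conj, Gen.comm, reduceCtorEq, if_true, if_false] <;> module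

theorem lap_up (g : Gen) (v : Symb) : lap (up g v) = up g (lap v) + (2 : ℂ) • down g.conj v := by
  simp only [lap, LinearMap.sum_apply, LinearMap.comp_apply, map_sum]
  cases g <;> simp only [Gen.sum_eq, Gen.conj, down_up, map_add, reduceCtorEq, if_true, if_false,
    map_zero] <;> module

theorem lap_down (g : Gen) (v : Symb) : lap (down g v) = down g (lap v) := by
  simp only [lap, LinearMap.sum_apply, LinearMap.comp_apply, map_sum]
  exact Finset.sum_congr rfl fun y _ => by rw [down_down y g, down_down y.conj g]

/-- Commuting the Laplacian past each multiplication leaves a second derivative in `a₊` and `b₋`. It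
arises twice, with coefficients of opposite sign, because `[a₋, a₊] = -[b₊, b₋]`. -/
theorem ad_Jminus_mem_Psi {ε : ℝ} {w : W ε} (hw : w ∈ Psi ε) : ad (Jminus ε) w ∈ Psi ε := by
  rw [mem_Psi_iff] at hw ⊢
  rw [Jminus, symb_ad_gen_mul_gen]
  simp only [map_add, map_smul, lap_up, lap_down, hw, map_zero, Gen.conj, Gen.comm, zero_add,
    down_down .bM .aP]
  module

theorem ad_K₀_apply (ε : ℝ) (w : W ε) :
    ad (K₀ ε) w = (1 / 2 : ℂ) •
      (ad (gen ε .aP * gen ε .aM) w + ad (gen ε .bP * gen ε .bM) w) := by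
  simp only [ad_apply, K₀, smul_mul_assoc, mul_smul_comm, add_mul, mul_add,
    ← Algebra.commutes (ε : ℂ) w]
  module

/-- The same cancellation as for `J₋`, now separately within the `a` pair and the `b` pair. -/
theorem ad_K₀_mem_Psi {ε : ℝ} {w : W ε} (hw : w ∈ Psi ε) : ad (K₀ ε) w ∈ Psi ε := by
  rw [mem_Psi_iff] at hw ⊢
  rw [ad_K₀_apply, map_smul, map_add, symb_ad_gen_mul_gen, symb_ad_gen_mul_gen]
  simp only [map_add, map_smul, lap_up, lap_down, hw, map_zero, Gen.conj, Gen.comm,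
    down_down .aM .aP, down_down .bM .bP]
  module

/-! ### Weights under `Ad K₀` and the projection `ρ` -/

theorem mem_PsiR_iff {ε : ℝ} {r : ℤ} {w : W ε} :
    w ∈ PsiR ε r ↔ w ∈ Psi ε ∧ ad (K₀ ε) w = ((ε : ℂ) * ((r : ℂ) / 2)) • w := by
  rw [PsiR, Submodule.mem_inf, LinearMap.mem_ker, LinearMap.sub_apply, sub_eq_zero]
  rfl

theorem ad_K₀_mul {ε : ℝ} {c d : ℂ} {v w : W ε} (hv : ad (K₀ ε) v = c • v)
    (hw : ad (K₀ ε) w = d • w) : ad (K₀ ε) (v * w) = (c + d) • (v * w) := by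
  rw [ad_mul, hv, hw, smul_mul_assoc, mul_smul_comm, add_smul]

theorem sub_rho_mem_leftIdeal (ε R : ℝ) (w : W ε) :
    w - (rho ε R w : W ε) ∈ leftIdeal ε (Rhat ε R) := by
  have h : rho ε R (w - (rho ε R w : W ε)) = 0 := by
    rw [map_sub, sub_eq_zero]
    exact (Submodule.projectionOnto_apply_left (isCompl_Psi_leftIdeal ε (Rhat ε R)) _).symm
  exact (Submodule.projectionOnto_apply_eq_zero_iff (isCompl_Psi_leftIdeal ε (Rhat ε R))).1 h

/-- With `p = ρ(w)`, the defect `Ad K₀ p - c p` lies in `Ψ`, which `Ad K₀` preserves. Up to sign it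
is also `Ad K₀ - c` applied to `w - p`, hence lies in the left ideal. The two spaces are
complementary, so it vanishes. -/
theorem rho_mem_PsiR {ε R : ℝ} {r : ℤ} {w : W ε}
    (hw : ad (K₀ ε) w = ((ε : ℂ) * ((r : ℂ) / 2)) • w) : (rho ε R w : W ε) ∈ PsiR ε r := by
  rw [mem_PsiR_iff]
  refine ⟨(rho ε R w).2, ?_⟩
  set c : ℂ := (ε : ℂ) * ((r : ℂ) / 2)
  obtain ⟨u, hu⟩ := sub_rho_mem_leftIdeal ε R w
  have hp := (rho ε R w).2
  generalize (rho ε R w : W ε) = p at hu hp ⊢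
  rw [LinearMap.mulRight_apply] at hu
  have h1 : ad (K₀ ε) p - c • p ∈ Psi ε :=
    sub_mem (ad_K₀_mem_Psi hp) (Submodule.smul_mem _ _ hp)
  have h2 : ad (K₀ ε) p - c • p ∈ leftIdeal ε (Rhat ε R) := by
    -- Here `w - p = u(K₀ - R̂)` and `Ad K₀` kills the right factor, so the derivation rule acts on
    -- `u` alone. The sign comes from `Ad K₀ w - c w = 0`.
    refine ⟨-(ad (K₀ ε) u - c • u), ?_⟩
    have e : ad (K₀ ε) (K₀ ε - algebraMap ℂ (W ε) (Rhat ε R)) = 0 := by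
      rw [ad_apply, mul_sub, sub_mul, Algebra.commutes, sub_self]
    have h3 : ad (K₀ ε) (w - p) - c • (w - p) = -(ad (K₀ ε) p - c • p) := by
      rw [map_sub, hw, smul_sub]
      abel
    rw [← hu, ad_mul, e, mul_zero, add_zero, ← smul_mul_assoc, ← sub_mul] at h3
    rw [LinearMap.mulRight_apply, neg_mul, h3, neg_neg]
  exact sub_eq_zero.1 (Submodule.disjoint_def.1
    (isCompl_Psi_leftIdeal ε (Rhat ε R)).disjoint _ h1 h2)

/-! ### The conjugation -/

theorem dagger_sub (ε : ℝ) (v w : W ε) : dagger ε (v - w) = dagger ε v - dagger ε w := by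
  rw [eq_sub_iff_add_eq, ← dagger_add, sub_add_cancel]

theorem dagger_smul (ε : ℝ) (c : ℂ) (w : W ε) :
    dagger ε (c • w) = starRingEnd ℂ c • dagger ε w := by
  rw [Algebra.smul_def, dagger_mul, dagger_algebraMap, ← Algebra.commutes, ← Algebra.smul_def]

theorem dagger_K₀ (ε : ℝ) : dagger ε (K₀ ε) = K₀ ε := by
  simp [K₀, dagger_smul, dagger_add, dagger_mul, dagger_gen, dagger_algebraMap, Gen.conj,
    Complex.conj_ofNat]

/-- An antiautomorphism fixing `K₀` reverses the commutator, which negates the weight; the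
eigenvalue itself is real. -/
theorem ad_K₀_dagger {ε : ℝ} {r : ℤ} {w : W ε}
    (hw : ad (K₀ ε) w = ((ε : ℂ) * ((r : ℂ) / 2)) • w) :
    ad (K₀ ε) (dagger ε w) = (-((ε : ℂ) * ((r : ℂ) / 2))) • dagger ε w := by
  have h := congrArg (dagger ε) hw
  rw [ad_apply, dagger_sub, dagger_mul, dagger_mul, dagger_K₀, dagger_smul] at h
  rw [ad_apply, ← neg_sub, h, neg_smul]
  simp [Complex.conj_ofNat]

/-! ### The basis elements -/

theorem ad_K₀_gen (ε : ℝ) (g : Gen) :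
    ad (K₀ ε) (gen ε g) = ((ε : ℂ) * ((shiftK g : ℂ) / 2)) • gen ε g := by
  have h : ∀ x y, ad (gen ε x * gen ε y) (gen ε g) =
      Gen.comm ε y g • gen ε x + Gen.comm ε x g • gen ε y := by
    intro x y
    have h1 : ∀ z, gen ε z * gen ε g = gen ε g * gen ε z + Gen.comm ε z g • 1 := fun z => by
      rw [gen_mul_gen, Algebra.algebraMap_eq_smul_one]
    rw [ad_apply, mul_assoc, h1 y, mul_add, ← mul_assoc, h1 x, add_mul, mul_smul_comm,
      smul_mul_assoc, mul_one, one_mul, mul_assoc]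
    abel
  rw [ad_K₀_apply, h, h]
  cases g <;> simp only [Gen.comm, shiftK] <;> push_cast <;> module

theorem ad_K₀_pow {ε : ℝ} {c : ℂ} {w : W ε} (hw : ad (K₀ ε) w = c • w) (n : ℕ) :
    ad (K₀ ε) (w ^ n) = (n * c) • w ^ n := by
  induction n with
  | zero => simp [ad_apply]
  | succ n ih =>
    rw [pow_succ, ad_K₀_mul ih hw]
    push_cast
    rw [add_mul, one_mul]

theorem ad_K₀_Jminus (ε : ℝ) : ad (K₀ ε) (Jminus ε) = 0 := by
  rw [Jminus, ad_K₀_mul (ad_K₀_gen ε .aM) (ad_K₀_gen ε .bP)]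
  simp only [shiftK]
  push_cast
  module

theorem ad_Jminus_mem_PsiR {ε : ℝ} {r : ℤ} {w : W ε} (hw : w ∈ PsiR ε r) :
    ad (Jminus ε) w ∈ PsiR ε r := by
  rw [mem_PsiR_iff] at hw ⊢
  refine ⟨ad_Jminus_mem_Psi hw.1, ?_⟩
  have h : ad (K₀ ε) (Jminus ε) = (0 : ℂ) • Jminus ε := by rw [ad_K₀_Jminus, zero_smul]
  rw [ad_apply (Jminus ε), map_sub, ad_K₀_mul h hw.2, ad_K₀_mul hw.2 h, zero_add, add_zero,
    smul_sub]

/-- The symbol involves neither `a₋` nor `b₊`, while every term of the Laplacian differentiates in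
one of them. -/
theorem pow_mul_pow_mem_Psi (ε : ℝ) (p q : ℕ) : gen ε .aP ^ p * gen ε .bM ^ q ∈ Psi ε := by
  have h : down .aM (symb ε (gen ε .aP ^ p * gen ε .bM ^ q)) = 0 ∧
      down .bP (symb ε (gen ε .aP ^ p * gen ε .bM ^ q)) = 0 := by
    induction p with
    | zero =>
      induction q with
      | zero => simp [symb_one]
      | succ q ih =>
        rw [pow_zero, one_mul] at ih ⊢
        rw [pow_succ', symb_gen_mul]
        simp [leftOp, down_up, Gen.conj, ih.1, ih.2]
    | succ p ih =>
      rw [pow_succ', mul_assoc, symb_gen_mul]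
      simp [leftOp, down_up, Gen.conj, ih.1, ih.2]
  rw [mem_Psi_iff, lap, LinearMap.sum_apply]
  simp only [LinearMap.comp_apply, Gen.sum_eq, Gen.conj, h.1, h.2, down_down .aM .aP,
    down_down .bP .bM, map_zero, add_zero]

theorem pow_mul_pow_mem_PsiR (ε : ℝ) (p q : ℕ) :
    gen ε .aP ^ p * gen ε .bM ^ q ∈ PsiR ε (p - q) := by
  rw [mem_PsiR_iff]
  refine ⟨pow_mul_pow_mem_Psi ε p q, ?_⟩
  rw [ad_K₀_mul (ad_K₀_pow (ad_K₀_gen ε .aP) p) (ad_K₀_pow (ad_K₀_gen ε .bM) q)]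
  congr 1
  simp only [shiftK]
  push_cast
  ring

theorem ad_Jminus_pow_mem_PsiR {ε : ℝ} {r : ℤ} {w : W ε} (hw : w ∈ PsiR ε r) (n : ℕ) :
    (ad (Jminus ε) ^ n) w ∈ PsiR ε r := by
  induction n with
  | zero => exact hw
  | succ n ih =>
    rw [pow_succ', Module.End.mul_apply]
    exact ad_Jminus_mem_PsiR ih

theorem basisP_mem_PsiR (ε : ℝ) {twoN : ℕ} {twoR : ℤ} (twoM : ℤ) (hr : |twoR| ≤ twoN)
    (he : Even ((twoN : ℤ) + twoR)) : basisP ε twoN twoR twoM ∈ PsiR ε twoR := by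
  refine Submodule.smul_mem _ _ (ad_Jminus_pow_mem_PsiR ?_ _)
  have h := pow_mul_pow_mem_PsiR ε ((twoN + twoR) / 2).toNat ((twoN - twoR) / 2).toNat
  obtain ⟨c, hc⟩ := he
  rw [abs_le] at hr
  rwa [show (((twoN + twoR) / 2).toNat : ℤ) - (((twoN - twoR) / 2).toNat : ℤ) = twoR by omega] at h

/-! ### Matrix elements in the Fock representation -/

theorem bra_ket {K J K' J' : ℤ} (h : |J'| ≤ K' ∧ Even (K' + J')) :
    bra K J (ket K' J') = if K = K' ∧ J = J' then 1 else 0 := by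
  rw [bra, ket, dif_pos h]
  split_ifs with h1 h2 h2
  · obtain ⟨rfl, rfl⟩ := h2
    simp
  · rw [Finsupp.lapply_apply, Finsupp.single_apply, if_neg]
    rintro ⟨⟩
    exact h2 ⟨rfl, rfl⟩
  · obtain ⟨rfl, rfl⟩ := h2
    exact absurd h h1
  · rfl

theorem ket_apply (K J : ℤ) (p : FockLabel) :
    ket K J p = if K = p.1.1 ∧ J = p.1.2 then 1 else 0 := by
  obtain ⟨⟨K', J'⟩, hp⟩ := p
  rw [ket]
  split_ifs with h1 h2 h2
  · obtain ⟨rfl, rfl⟩ := h2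
    simp
  · rw [Finsupp.single_apply, if_neg]
    rintro ⟨⟩
    exact h2 ⟨rfl, rfl⟩
  · obtain ⟨rfl, rfl⟩ := h2
    exact absurd hp h1
  · rfl

theorem bra_apply (p : FockLabel) (x : Fock) : bra p.1.1 p.1.2 x = x p := by
  rw [bra, dif_pos p.2]
  rfl

theorem single_eq_smul_ket (p : FockLabel) (c : ℂ) :
    Finsupp.single p c = c • ket p.1.1 p.1.2 := by
  rw [ket, dif_pos p.2, Finsupp.smul_single, smul_eq_mul, mul_one]

/-! ### The Fock inner product and the adjoint -/

/-- The inner product on the finite linear combinations of the Fock basis. -/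
noncomputable def fockForm (x y : Fock) : ℂ := x.sum fun p c => starRingEnd ℂ c * y p

theorem fockForm_add_left (x x' y : Fock) :
    fockForm (x + x') y = fockForm x y + fockForm x' y := by
  simp only [fockForm]
  rw [Finsupp.sum_add_index'] <;> intros <;> simp [add_mul]

theorem fockForm_smul_left (c : ℂ) (x y : Fock) :
    fockForm (c • x) y = starRingEnd ℂ c * fockForm x y := by
  rw [fockForm, fockForm, Finsupp.sum_smul_index' (fun _ => by simp), Finsupp.mul_sum]
  simp [mul_assoc]

theorem fockForm_zero_left (y : Fock) : fockForm 0 y = 0 := by simp [fockForm]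

theorem fockForm_add_right (x y y' : Fock) :
    fockForm x (y + y') = fockForm x y + fockForm x y' := by
  simp [fockForm, mul_add, Finsupp.sum_add]

theorem fockForm_smul_right (c : ℂ) (x y : Fock) : fockForm x (c • y) = c * fockForm x y := by
  simp [fockForm, Finsupp.mul_sum, mul_left_comm]

theorem fockForm_zero_right (x : Fock) : fockForm x 0 = 0 := by simp [fockForm]

theorem fockForm_sum_left {ι : Type*} (s : Finset ι) (F : ι → Fock) (y : Fock) :
    fockForm (∑ i ∈ s, F i) y = ∑ i ∈ s, fockForm (F i) y := by
  classical
  induction s using Finset.induction_on with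
  | empty => simp [fockForm_zero_left]
  | insert i s hi ih => rw [Finset.sum_insert hi, Finset.sum_insert hi, fockForm_add_left, ih]

theorem fockForm_ket (K J : ℤ) (y : Fock) : fockForm (ket K J) y = bra K J y := by
  rw [ket, bra]
  split_ifs <;> simp [fockForm]

/-- By sesquilinearity it suffices to test basis kets. Both sides vanish unless the labels differ by
the shift of `g`, and then the two real amplitudes coincide. -/
theorem fockForm_fockOp (ε : ℝ) (g : Gen) (x y : Fock) :
    fockForm (fockOp ε g x) y = fockForm x (fockOp ε g.conj y) := by
  induction x using Finsupp.induction_linear with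
  | zero => simp [fockForm_zero_left]
  | add x x' hx hx' => rw [map_add, fockForm_add_left, fockForm_add_left, hx, hx']
  | single p c =>
  induction y using Finsupp.induction_linear with
  | zero => simp [fockForm_zero_right]
  | add y y' hy hy' => rw [map_add, fockForm_add_right, fockForm_add_right, hy, hy']
  | single q d =>
  obtain ⟨⟨K, J⟩, hp⟩ := p
  obtain ⟨⟨K', J'⟩, hq⟩ := q
  simp only [single_eq_smul_ket, map_smul, fockForm_smul_left, fockForm_smul_right,
    fockOp_ket ε _ hp, fockOp_ket ε _ hq, fockForm_ket, bra_ket hq, Complex.conj_ofReal]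
  rw [show ∀ x, bra K J x = x ⟨(K, J), hp⟩ from bra_apply ⟨(K, J), hp⟩, ket_apply]
  by_cases h : K + shiftK g = K' ∧ J + shiftJ g = J'
  · obtain ⟨rfl, rfl⟩ := h
    have e : amp g.conj (K + shiftK g) (J + shiftJ g) = amp g K J := by
      cases g <;> simp only [Gen.conj, amp, shiftK, shiftJ] <;> push_cast <;> ring_nf
    rw [e, if_pos ⟨rfl, rfl⟩, if_pos]
    · ring
    · cases g <;> simp [Gen.conj, shiftK, shiftJ]
  · rw [if_neg h, if_neg]
    · ring
    · cases g <;> simp only [Gen.conj, shiftK, shiftJ] at h ⊢ <;> omega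

theorem fockRep_gen {ε : ℝ} (hε : 0 < ε) (g : Gen) : fockRep hε (gen ε g) = fockOp ε g :=
  W.lift_gen ..

theorem fockForm_fockRep {ε : ℝ} (hε : 0 < ε) (w : W ε) (x y : Fock) :
    fockForm (fockRep hε w x) y = fockForm x (fockRep hε (dagger ε w) y) := by
  induction w using W.induction generalizing x y with
  | algebraMap c =>
    simp only [dagger_algebraMap, AlgHom.commutes, Module.algebraMap_end_apply,
      fockForm_smul_left, fockForm_smul_right]
  | gen g => rw [dagger_gen, fockRep_gen, fockRep_gen, fockForm_fockOp]
  | mul v w hv hw => simp only [dagger_mul, map_mul, Module.End.mul_apply, hv, hw]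
  | add v w hv hw =>
    simp only [dagger_add, map_add, LinearMap.add_apply, fockForm_add_left, fockForm_add_right,
      hv, hw]

/-! ### Level subspaces as eigenspaces of `K₀` -/

/-- The level subspace spanned by the `|k,j⟩` with `2k = L`. -/
noncomputable def fockLevel (L : ℤ) : Submodule ℂ Fock :=
  Finsupp.supported ℂ ℂ {p : FockLabel | p.1.1 = L}

theorem mem_fockLevel {L : ℤ} {x : Fock} : x ∈ fockLevel L ↔ ∀ p, p.1.1 ≠ L → x p = 0 := by
  rw [fockLevel, Finsupp.mem_supported']
  rfl

theorem ket_mem_fockLevel (L J : ℤ) : ket L J ∈ fockLevel L := by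
  rw [mem_fockLevel]
  intro p hp
  rw [ket_apply, if_neg fun h => hp h.1.symm]

/-- The number operators `a₊a₋` and `b₊b₋` have eigenvalues `ε(k+j)` and `ε(k-j)`; the dependence on
`j` cancels in the sum. -/
theorem fockRep_K₀_ket {ε : ℝ} (hε : 0 < ε) {K J : ℤ} (h : |J| ≤ K ∧ Even (K + J)) :
    fockRep hε (K₀ ε) (ket K J) = ((ε : ℂ) * ((K : ℂ) / 2 + 1 / 2)) • ket K J := by
  have hK := abs_le.1 h.1
  have h1 : (0 : ℝ) ≤ (K : ℝ) / 2 + (J : ℝ) / 2 := by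
    have : (0 : ℝ) ≤ ((K + J : ℤ) : ℝ) := by exact_mod_cast (by omega)
    push_cast at this; linarith
  have h2 : (0 : ℝ) ≤ (K : ℝ) / 2 - (J : ℝ) / 2 := by
    have : (0 : ℝ) ≤ ((K - J : ℤ) : ℝ) := by exact_mod_cast (by omega)
    push_cast at this; linarith
  simp only [K₀, map_smul, map_add, map_mul, AlgHom.commutes, fockRep_gen, LinearMap.smul_apply,
    LinearMap.add_apply, Module.End.mul_apply, fockOp_fockOp_ket hε.le _ _ h, amp, shiftK, shiftJ,
    Module.algebraMap_end_apply, neg_add_cancel_right]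
  have n1 : ((K + -1 : ℤ) : ℝ) / 2 + ((J + -1 : ℤ) : ℝ) / 2 + 1 = (K : ℝ) / 2 + (J : ℝ) / 2 := by
    push_cast; ring
  have n2 : ((K + -1 : ℤ) : ℝ) / 2 - ((J + 1 : ℤ) : ℝ) / 2 + 1 = (K : ℝ) / 2 - (J : ℝ) / 2 := by
    push_cast; ring
  rw [n1, n2, Real.mul_self_sqrt h1, Real.mul_self_sqrt h2, add_neg_cancel_right]
  push_cast
  module

theorem fockRep_K₀_apply {ε : ℝ} (hε : 0 < ε) (x : Fock) (p : FockLabel) :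
    fockRep hε (K₀ ε) x p = ((ε : ℂ) * ((p.1.1 : ℂ) / 2 + 1 / 2)) * x p := by
  induction x using Finsupp.induction_linear with
  | zero => simp
  | add x y hx hy => rw [map_add, Finsupp.add_apply, hx, hy, Finsupp.add_apply]; ring
  | single q c =>
    rw [single_eq_smul_ket, map_smul, fockRep_K₀_ket hε q.2, Finsupp.smul_apply,
      Finsupp.smul_apply, Finsupp.smul_apply, ket_apply]
    split_ifs with h
    · rw [h.1]
      simp only [smul_eq_mul]
      ring
    · simp

theorem fockRep_K₀_of_mem {ε : ℝ} (hε : 0 < ε) {L : ℤ} {x : Fock} (hx : x ∈ fockLevel L) :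
    fockRep hε (K₀ ε) x = ((ε : ℂ) * ((L : ℂ) / 2 + 1 / 2)) • x := by
  ext p
  rw [fockRep_K₀_apply, Finsupp.smul_apply, smul_eq_mul]
  by_cases h : p.1.1 = L
  · rw [h]
  · rw [mem_fockLevel.1 hx p h, mul_zero, mul_zero]

/-- Taking the coefficient at `p` of the eigenvalue equation multiplies the coefficient of `w x` by
a scalar proportional to the distance of `p` from level `L + r`. Off that level the scalar is
nonzero as `ε ≠ 0`. -/
theorem fockRep_mem_fockLevel {ε : ℝ} (hε : 0 < ε) {r L : ℤ} {w : W ε}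
    (hw : ad (K₀ ε) w = ((ε : ℂ) * ((r : ℂ) / 2)) • w) {x : Fock} (hx : x ∈ fockLevel L) :
    fockRep hε w x ∈ fockLevel (L + r) := by
  rw [mem_fockLevel]
  intro p hp
  have h := congrArg (fun u => fockRep hε u x p) hw
  simp only [ad_apply, map_sub, map_mul, LinearMap.sub_apply, Module.End.mul_apply, map_smul,
    LinearMap.smul_apply, fockRep_K₀_of_mem hε hx, Finsupp.sub_apply, Finsupp.smul_apply,
    fockRep_K₀_apply, smul_eq_mul] at h
  have hne : (ε : ℂ) * ((p.1.1 : ℂ) - (L + r : ℤ)) ≠ 0 := by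
    refine mul_ne_zero (by exact_mod_cast hε.ne') (sub_ne_zero.2 ?_)
    exact_mod_cast hp
  refine (mul_eq_zero.1 ?_).resolve_left hne
  push_cast
  linear_combination 2 * h

/-- The resolution of the identity on one level. It includes the empty case `L = -1`, `D = 0`, where
the level is zero. -/
theorem eq_sum_ket {L : ℤ} {D : ℕ} (hD : (D : ℤ) = L + 1) {x : Fock} (hx : x ∈ fockLevel L) :
    x = ∑ μ : Fin D, bra L (2 * (μ : ℤ) - L) x • ket L (2 * (μ : ℤ) - L) := by
  ext ⟨⟨K, J⟩, hp⟩
  simp only [Finsupp.finsetSum_apply, Finsupp.smul_apply, ket_apply, smul_eq_mul]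
  by_cases h : K = L
  · subst h
    obtain ⟨hJ, c, hc⟩ := hp
    have hJ' := abs_le.1 hJ
    -- The only contributing index is half of `K + J`, an integer by the parity condition on labels.
    rw [Finset.sum_eq_single (⟨c.toNat, by omega⟩ : Fin D)]
    · have e : 2 * ((c.toNat : ℕ) : ℤ) - K = J := by omega
      simp only [e, and_self, if_true, mul_one]
      exact (bra_apply ⟨(K, J), hJ, c, hc⟩ x).symm
    · intro μ _ hμ
      rw [if_neg, mul_zero]
      rintro ⟨-, h⟩
      exact hμ (Fin.ext (by simp only; omega))
    · simp
  · rw [mem_fockLevel.1 hx _ h, Finset.sum_eq_zero]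
    intro μ _
    rw [if_neg fun h' => h h'.1.symm, mul_zero]

/-- The only use of the quantization of `R̂`: it makes `K₀ - R̂`, and hence the whole left ideal,
act as zero on this level. -/
theorem fockRep_rho {ε R : ℝ} (hε : 0 < ε) {K : ℤ}
    (hk : Rhat ε R = ε * ((K : ℝ) / 2 + 1 / 2)) (w : W ε) {x : Fock} (hx : x ∈ fockLevel K) :
    fockRep hε (rho ε R w : W ε) x = fockRep hε w x := by
  obtain ⟨u, hu⟩ := sub_rho_mem_leftIdeal ε R w
  have h : fockRep hε (w - (rho ε R w : W ε)) x = 0 := by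
    rw [← hu, LinearMap.mulRight_apply, map_mul, Module.End.mul_apply, map_sub,
      LinearMap.sub_apply, AlgHom.commutes, Module.algebraMap_end_apply,
      fockRep_K₀_of_mem hε hx, hk]
    push_cast
    rw [sub_self, map_zero]
  rw [map_sub, LinearMap.sub_apply, sub_eq_zero] at h
  exact h.symm

/-! ### Vanishing on low levels -/

/-- Each `b₋` lowers `K - J` by two. A negative value is no label, so `ket` is zero by its default,
which is the base case. -/
theorem fockOp_bM_pow_ket (ε : ℝ) (q : ℕ) {K J : ℤ} (h : K - J < 2 * q) :
    (fockOp ε .bM ^ q) (ket K J) = 0 := by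
  induction q generalizing K J with
  | zero =>
    rw [pow_zero, Module.End.one_apply, ket, dif_neg]
    rintro ⟨h', -⟩
    have := (abs_le.1 h').2
    simp at h
    omega
  | succ q ih =>
    rw [pow_succ, Module.End.mul_apply]
    by_cases hKJ : |J| ≤ K ∧ Even (K + J)
    · rw [fockOp_ket ε .bM hKJ, map_smul, ih, smul_zero]
      simp only [shiftK, shiftJ]
      push_cast at h
      omega
    · rw [ket, dif_neg hKJ, map_zero, map_zero]

theorem fockRep_pow_mul_pow_eq_zero {ε : ℝ} (hε : 0 < ε) (p : ℕ) {q : ℕ} {K : ℤ} (h : K < q)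
    {x : Fock} (hx : x ∈ fockLevel K) :
    fockRep hε (gen ε .aP ^ p * gen ε .bM ^ q) x = 0 := by
  rw [← Finsupp.sum_single x, Finsupp.sum, map_sum]
  refine Finset.sum_eq_zero fun y hy => ?_
  have hK : y.1.1 = K := by
    by_contra hne
    exact Finsupp.mem_support_iff.1 hy (mem_fockLevel.1 hx y hne)
  have := (abs_le.1 y.2.1).1
  rw [single_eq_smul_ket, map_smul, map_mul, Module.End.mul_apply, map_pow, map_pow,
    fockRep_gen, fockRep_gen, fockOp_bM_pow_ket ε q (by omega), map_zero, smul_zero]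

/-- Both terms of a commutator with `J₋` vanish on the level: in one `w` acts first, in the other it
acts on `J₋ x`, which is again in the level because `J₋` has weight zero. -/
theorem fockRep_ad_Jminus_pow_eq_zero {ε : ℝ} (hε : 0 < ε) {w : W ε} {K : ℤ}
    (hw : ∀ x ∈ fockLevel K, fockRep hε w x = 0) (n : ℕ) :
    ∀ x ∈ fockLevel K, fockRep hε ((ad (Jminus ε) ^ n) w) x = 0 := by
  induction n with
  | zero => exact hw
  | succ n ih =>
    intro x hx
    have hJ : fockRep hε (Jminus ε) x ∈ fockLevel K := by
      have := fockRep_mem_fockLevel hε (r := 0) (w := Jminus ε) (by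
        rw [ad_K₀_Jminus]; simp) hx
      rwa [add_zero] at this
    rw [pow_succ', Module.End.mul_apply, ad_apply, map_sub, map_mul, map_mul,
      LinearMap.sub_apply, Module.End.mul_apply, Module.End.mul_apply, ih x hx, ih _ hJ, map_zero,
      sub_zero]

theorem fockRep_basisP_eq_zero {ε : ℝ} (hε : 0 < ε) {twoN : ℕ} {twoR : ℤ} (twoM : ℤ) {K : ℤ}
    (h : 2 * K + twoR + 2 ≤ twoN) {x : Fock} (hx : x ∈ fockLevel K) :
    fockRep hε (basisP ε twoN twoR twoM) x = 0 := by
  -- With `K = 2k`, the bound `n ≥ 2k + r + 1` makes the exponent `n - r` of `b₋` exceed `K`.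
  rw [basisP, map_smul, LinearMap.smul_apply, fockRep_ad_Jminus_pow_eq_zero hε
    (fun y hy => fockRep_pow_mul_pow_eq_zero hε _ (by omega) hy) _ x hx, smul_zero]

/-! ### The matrices -/

theorem phi_apply {ε : ℝ} (hε : 0 < ε) (D twoK : ℕ) (twoR : ℤ) (ξ : PsiR ε twoR) (μ : Fin D)
    (ν : Fin (twoK + 1)) :
    phi hε D twoK twoR ξ μ ν = bra (twoK + twoR) (2 * (μ : ℤ) - (twoK + twoR))
      (fockRep hε (ξ : W ε) (ket twoK (2 * (ν : ℤ) - twoK))) := rfl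

end NCSphere

theorem mainTheorem8 (ε R : ℝ) (hε : 0 < ε) (hR : 0 ≤ R) (twoK : ℕ) (twoR : ℤ) (D : ℕ)
    (hD : (D : ℤ) = twoK + twoR + 1)
    (hk : NCSphere.Rhat ε R = ε * ((twoK : ℝ) / 2 + 1 / 2)) :
    (∀ (ξ : NCSphere.PsiR ε twoR) (f : NCSphere.PsiR ε 0),
      ∃ h : (NCSphere.rho ε R ((ξ : NCSphere.W ε) * (f : NCSphere.W ε)) : NCSphere.W ε) ∈
          NCSphere.PsiR ε twoR,
        NCSphere.phi hε D twoK twoR ⟨_, h⟩ =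
          NCSphere.phi hε D twoK twoR ξ * NCSphere.phi hε (twoK + 1) twoK 0 f) ∧
    (∀ ξ ζ : NCSphere.PsiR ε twoR,
      ∃ h : (NCSphere.rho ε R (NCSphere.dagger ε (ξ : NCSphere.W ε) * (ζ : NCSphere.W ε)) :
          NCSphere.W ε) ∈ NCSphere.PsiR ε 0,
        (NCSphere.phi hε D twoK twoR ξ).conjTranspose * NCSphere.phi hε D twoK twoR ζ =
          NCSphere.phi hε (twoK + 1) twoK 0 ⟨_, h⟩) ∧
    (∀ (twoN : ℕ) (twoM : ℤ), |twoR| ≤ twoN → |twoM| ≤ twoN →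
      Even ((twoN : ℤ) + twoR) → Even ((twoN : ℤ) + twoM) →
      2 * (twoK : ℤ) + twoR + 2 ≤ twoN →
      ∃ h : NCSphere.basisP ε twoN twoR twoM ∈ NCSphere.PsiR ε twoR,
        NCSphere.phi hε D twoK twoR ⟨_, h⟩ = 0) := by
  open NCSphere in
  have hk' : Rhat ε R = ε * (((twoK : ℤ) : ℝ) / 2 + 1 / 2) := by rw [hk, Int.cast_natCast]
  refine ⟨fun ξ f => ?_, fun ξ ζ => ?_, fun twoN twoM hr _ he _ hn => ?_⟩
  · have hξ := (mem_PsiR_iff.1 ξ.2).2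
    have hf := (mem_PsiR_iff.1 f.2).2
    refine ⟨rho_mem_PsiR ?_, ?_⟩
    · rw [ad_K₀_mul hξ hf]
      simp
    · ext μ ν
      have hx := ket_mem_fockLevel twoK (2 * (ν : ℤ) - twoK)
      -- Since `f` has weight zero, its image of the ket stays in level `k`; expanding it there
      -- gives the summation index of the matrix product.
      have h := eq_sum_ket (D := twoK + 1) (by push_cast; ring) (fockRep_mem_fockLevel hε hf hx)
      rw [phi_apply, fockRep_rho hε hk' _ hx, map_mul, Module.End.mul_apply, h, map_sum, map_sum,
        Matrix.mul_apply]
      refine Finset.sum_congr rfl fun κ _ => ?_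
      rw [phi_apply, phi_apply, map_smul, map_smul, smul_eq_mul, mul_comm, add_zero]
  · have hξ := (mem_PsiR_iff.1 ξ.2).2
    have hζ := (mem_PsiR_iff.1 ζ.2).2
    refine ⟨rho_mem_PsiR ?_, ?_⟩
    · rw [ad_K₀_mul (ad_K₀_dagger hξ) hζ]
      simp
    · ext ν ν'
      have hx := ket_mem_fockLevel twoK (2 * (ν' : ℤ) - twoK)
      -- The vector expanded is the left one, `ξ|k,ν⟩` in level `k + r`. The form is
      -- conjugate-linear in it, which yields the entries of the conjugate transpose.
      have h := eq_sum_ket (D := D) hD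
        (fockRep_mem_fockLevel hε hξ (ket_mem_fockLevel twoK (2 * (ν : ℤ) - twoK)))
      -- Writing the bra as an inner product with a ket allows `ξ†` to be moved to the left argument
      -- as `ξ`.
      rw [phi_apply, fockRep_rho hε hk' _ hx, add_zero, ← fockForm_ket, map_mul,
        Module.End.mul_apply, ← fockForm_fockRep, h, fockForm_sum_left, Matrix.mul_apply]
      refine Finset.sum_congr rfl fun μ _ => ?_
      rw [fockForm_smul_left, fockForm_ket, Matrix.conjTranspose_apply, phi_apply, phi_apply]
      rfl
  · refine ⟨basisP_mem_PsiR ε twoM hr he, ?_⟩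
    ext μ ν
    rw [phi_apply, fockRep_basisP_eq_zero hε twoM hn (ket_mem_fockLevel _ _), map_zero]
    rfl
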